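/- Let $X$ be a finite-dimensional real smooth manifold without boundary, Hausdorff and second-countable. Let $C^\infty_X$ be the sheaf of smooth real functions on $X$, $\mathcal O^1_X$ the sheaf of smooth differential one-forms and $d\colon C^\infty_X\to\mathcal O^1_X$ the exterior differential. A sheaf $\mathfrak P$ of $C^\infty_X$-modules is called locally free if every point of $X$ has an open neighbourhood $U$ such that $\mathfrak P|_U$ is isomorphic to a (possibly infinite) direct sum of copies of $C^\infty_X|_U$. A $C^\infty(X)$-module is called locally free if it is isomorphic to the module $\mathfrak P(X)$ of global sections of a locally free sheaf $\mathfrak P$ of $C^\infty_X$-modules. For a commutative ring $\mathcal A$ with a derivation $d\colon\mathcal A\to\mathcal O^1$ into an $\mathcal A$-module and an $\mathcal A$-module $P$, put $\mathcal J^1(P)=(\mathcal A\oplus\mathcal O^1)\otimes_{\mathcal A}P$, where the tensor product is formed over the right module structure $(a+\theta)\cdot f=af+(f\theta+a\,df)$ on $\mathcal A\oplus\mathcal O^1$ and $\mathcal J^1(P)$ is an $\mathcal A$-module through the left structure $f(a+\theta)=fa+f\theta$; thus $1\otimes fp=f\otimes p+df\otimes p$. The jet sequence of $P$ is $$0\to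 \mathcal O^1\otimes P\to \mathcal J^1(P)\to P\to 0,\qquad \theta\otimes p\mapsto \theta\otimes p,\quad (a+\theta)\otimes p\mapsto ap .$$ The jet sequence $0\to\mathcal O^1_X\otimes\mathfrak P\to(C^\infty_X\oplus\mathcal O^1_X)\otimes\mathfrak P\to\mathfrak P\to0$ of a sheaf $\mathfrak P$ of $C^\infty_X$-modules is obtained from these sequences for $\mathfrak P(U)$ over $C^\infty(U)$, $U\subset X$ open, by passing to the associated sheaves. 1. Every locally free sheaf $\mathfrak P$ of $C^\infty_X$-modules admits a connection: its jet sequence splits as a sequence of sheaves of $C^\infty_X$-modules and, equivalently, there is a morphism of sheaves of real vector spaces $\nabla\colon\mathfrak P\to\mathcal O^1_X\otimes\mathfrak P$ such that $\nabla(fs)=df\otimes s+f\nabla(s)$ for all open $U\subset X$, $f\in C^\infty(U)$ and $s\in\mathfrak P(U)$. 2. Every locally free $C^\infty(X)$-module $P$ admits a connection: its jet sequence $0\to\mathcal O^1(X)\otimes P\to\mathcal J^1(P)\to P\to0$, where $\mathcal O^1(X)$ is the module of smooth one-forms on $X$ and the tensor products are over $C^\infty(X)$, splits as a sequence of $C^\infty(X)$-modules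 and, equivalently, there is an $\mathbb R$-linear map $\nabla\colon P\to\mathcal O^1(X)\otimes P$ such that $\nabla(fp)=df\otimes p+f\nabla(p)$ for all $f\in C^\infty(X)$ and $p\in P$. -/

import Mathlib

open CategoryTheory TopologicalSpace Opposite TensorProduct Bundle
open scoped Manifold ContDiff

noncomputable section

namespace SmoothJets

universe u

section Algebra

variable {A Ω : Type u} [CommRing A] [AddCommGroup Ω] [Module A Ω]

/-- For a ring `A` with a derivation `d : A → Ω`, the bimodule `𝒥¹ = A ⊕ Ω` of first order jets of
`A`. Its left structure is componentwise (`JetBimodule.leftMul`), its right structure `f • _` is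
given by `f • 1 = f + d f` (the `Module` instance below). -/
def JetBimodule (_d : Derivation ℤ A Ω) : Type u := A × Ω

variable (d : Derivation ℤ A Ω)

instance : AddCommGroup (JetBimodule d) := inferInstanceAs (AddCommGroup (A × Ω))

/-- The element `a + θ` of `A ⊕ Ω`. -/
def JetBimodule.mk (a : A) (θ : Ω) : JetBimodule d := (a, θ)

/-- The right (`•`) module structure `f • (a + θ) = f a + (f θ + a d f)`; it is the one over which
the tensor product `𝒥¹ ⊗ P` is formed. -/
instance : Module A (JetBimodule d) where
  smul f x := JetBimodule.mk d (f * x.1) (f • x.2 + x.1 • d f)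
  one_smul x := Prod.ext (one_mul x.1)
    (show (1 : A) • x.2 + x.1 • d 1 = x.2 by simp)
  mul_smul f g x := Prod.ext (mul_assoc f g x.1)
    (show (f * g) • x.2 + x.1 • d (f * g) = f • (g • x.2 + x.1 • d g) + (g * x.1) • d f by
      rw [Derivation.leibniz]; module)
  smul_zero f := Prod.ext (mul_zero f)
    (show f • (0 : Ω) + (0 : A) • d f = 0 by simp)
  smul_add f x y := Prod.ext (mul_add f x.1 y.1)
    (show f • (x.2 + y.2) + (x.1 + y.1) • d f = (f • x.2 + x.1 • d f) + (f • y.2 + y.1 • d f) by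
      module)
  add_smul f g x := Prod.ext (add_mul f g x.1)
    (show (f + g) • x.2 + x.1 • d (f + g) = (f • x.2 + x.1 • d f) + (g • x.2 + x.1 • d g) by
      rw [map_add]; module)
  zero_smul x := Prod.ext (zero_mul x.1)
    (show (0 : A) • x.2 + x.1 • d 0 = 0 by simp)

/-- The left module structure `f (a + θ) = f a + f θ`, which commutes with the right one. -/
def JetBimodule.leftMul : A →+* Module.End A (JetBimodule d) where
  toFun f :=
    { toFun := fun x => JetBimodule.mk d (f * x.1) (f • x.2)
      map_add' := fun x y => Prod.ext (mul_add f x.1 y.1) (smul_add f x.2 y.2)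
      map_smul' := fun g x => Prod.ext (mul_left_comm f g x.1)
        (show f • (g • x.2 + x.1 • d g) = g • (f • x.2) + (f * x.1) • d g by module) }
  map_one' := LinearMap.ext fun x => Prod.ext (one_mul x.1) (one_smul A x.2)
  map_mul' f g := LinearMap.ext fun x => Prod.ext (mul_assoc f g x.1) (mul_smul f g x.2)
  map_zero' := LinearMap.ext fun x => Prod.ext (zero_mul x.1) (zero_smul A x.2)
  map_add' f g := LinearMap.ext fun x => Prod.ext (add_mul f g x.1) (add_smul f g x.2)

variable (P : Type u) [AddCommGroup P] [Module A P]

/-- The first order jet module `𝒥¹(P) = (A ⊕ Ω) ⊗_A P`, the tensor product being over the right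
structure of `A ⊕ Ω`.  In it `1 ⊗ a p = a ⊗ p + d a ⊗ p`. -/
def JetModule : Type u := JetBimodule d ⊗[A] P

instance : AddCommGroup (JetModule d P) := inferInstanceAs (AddCommGroup (JetBimodule d ⊗[A] P))

instance : Module A (JetModule d P) :=
  Module.compHom (JetBimodule d ⊗[A] P)
    ((Module.End.rTensorAlgHom A (JetBimodule d) P).toRingHom.comp (JetBimodule.leftMul d))

variable {P}

/-- The element `(a + θ) ⊗ p` of `𝒥¹(P)`. -/
def JetModule.mk (a : A) (θ : Ω) (p : P) : JetModule d P :=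
  JetBimodule.mk d a θ ⊗ₜ[A] p

theorem JetModule.smul_mk (f a : A) (θ : Ω) (p : P) :
    f • JetModule.mk d a θ p = JetModule.mk d (f * a) (f • θ) p := rfl

theorem JetModule.induction {motive : JetModule d P → Prop} (t : JetModule d P)
    (zero : motive 0) (mk : ∀ a θ p, motive (JetModule.mk d a θ p))
    (add : ∀ x y, motive x → motive y → motive (x + y)) : motive t :=
  TensorProduct.induction_on (motive := motive) t zero (fun x p => mk x.1 x.2 p) add

variable (P)

/-- The projection `𝒥¹(P) → P`, `(a + θ) ⊗ p ↦ a p`. -/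
def jetProj : JetModule d P →ₗ[A] P :=
  let g : JetBimodule d →ₗ[A] P →ₗ[A] P :=
    { toFun := fun x => LinearMap.lsmul A P x.1
      map_add' := fun x y => map_add (LinearMap.lsmul A P) x.1 y.1
      map_smul' := fun f x => map_smul (LinearMap.lsmul A P) f x.1 }
  { toFun := TensorProduct.lift g
    map_add' := map_add (TensorProduct.lift g)
    map_smul' := fun f t => by
      induction t using JetModule.induction with
      | zero => rw [smul_zero]; exact (map_zero (TensorProduct.lift g)).trans (smul_zero _).symm
      | mk a θ p => exact mul_smul f a p
      | add x y hx hy =>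
        rw [smul_add]
        refine (map_add (TensorProduct.lift g) _ _).trans ?_
        rw [hx, hy, ← smul_add]
        exact congrArg _ (map_add (TensorProduct.lift g) _ _).symm }

/-- The inclusion `Ω ⊗ P → 𝒥¹(P)`, `θ ⊗ p ↦ θ ⊗ p`. -/
def jetIncl : Ω ⊗[A] P →ₗ[A] JetModule d P :=
  let g : Ω →ₗ[A] JetBimodule d :=
    { toFun := fun θ => JetBimodule.mk d 0 θ
      map_add' := fun θ η => Prod.ext (add_zero 0).symm rfl
      map_smul' := fun f θ => Prod.ext (mul_zero f).symm
        (show f • θ = f • θ + (0 : A) • d f by simp) }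
  { toFun := g.rTensor P
    map_add' := map_add (g.rTensor P)
    map_smul' := fun f t => by
      induction t using TensorProduct.induction_on with
      | zero => rw [smul_zero]; exact (map_zero (g.rTensor P)).trans (smul_zero (A := JetModule d P) f).symm
      | tmul θ p =>
        exact congrArg (fun a : A => JetModule.mk d a (f • θ) p) (mul_zero f).symm
      | add x y hx hy =>
        rw [smul_add, map_add, hx, hy]
        refine (smul_add f (_ : JetModule d P) _).symm.trans (congrArg _ (map_add (g.rTensor P) _ _).symm) }

theorem jetProj_mk (a : A) (θ : Ω) (p : P) : jetProj d P (JetModule.mk d a θ p) = a • p := rfl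

theorem jetIncl_tmul (θ : Ω) (p : P) : jetIncl d P (θ ⊗ₜ p) = JetModule.mk d 0 θ p := rfl

theorem jetProj_comp_jetIncl : jetProj d P ∘ₗ jetIncl d P = 0 :=
  TensorProduct.ext' fun _ p => zero_smul A p

/-- The jet sequence `0 → Ω ⊗ P → 𝒥¹(P) → P → 0` of `A`-modules. A connection on `P` is a
splitting of it. -/
def jetSequence : ShortComplex (ModuleCat.{u} A) where
  X₁ := ModuleCat.of A (Ω ⊗[A] P)
  X₂ := ModuleCat.of A (JetModule d P)
  X₃ := ModuleCat.of A P
  f := ModuleCat.ofHom (jetIncl d P)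
  g := ModuleCat.ofHom (jetProj d P)
  zero := by
    ext1
    exact jetProj_comp_jetIncl d P

/-- A Koszul connection on the `A`-module `P`.  Additivity and the Leibniz rule give linearity over
all `a` with `d a = 0`, in particular over the real constants when `A = C^∞(X)`. -/
structure KoszulConnection where
  /-- the covariant differential -/
  nabla : P →+ Ω ⊗[A] P
  leibniz (a : A) (p : P) : nabla (a • p) = d a ⊗ₜ[A] p + a • nabla p

end Algebra

section Restrict

variable {A A' Ω Ω' P P' : Type u} [CommRing A] [CommRing A'] [AddCommGroup Ω] [Module A Ω]
  [AddCommGroup Ω'] [Module A' Ω'] [AddCommGroup P] [Module A P] [AddCommGroup P'] [Module A' P']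
  {σ : A →+* A'} {d : Derivation ℤ A Ω} {d' : Derivation ℤ A' Ω'}

/-- The map `𝒥¹(P) → 𝒥¹(P')` induced by a change of rings `σ` compatible with the derivations. -/
def JetModule.restrict (φ : Ω →ₛₗ[σ] Ω') (hφ : ∀ a, φ (d a) = d' (σ a)) (ψ : P →ₛₗ[σ] P') :
    JetModule d P →ₛₗ[σ] JetModule d' P' :=
  let g : JetBimodule d ⊗[A] P →+ JetModule d' P' :=
    TensorProduct.liftAddHom
      { toFun := fun x =>
          { toFun := fun p => JetModule.mk d' (σ x.1) (φ x.2) (ψ p)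
            map_zero' := by rw [map_zero]; exact TensorProduct.tmul_zero _ _
            map_add' := fun p q => by rw [map_add]; exact TensorProduct.tmul_add _ _ _ }
        map_zero' := AddMonoidHom.ext fun p => by
          have h : JetBimodule.mk d' (σ 0) (φ 0) = 0 :=
            Prod.ext (map_zero σ) (map_zero φ)
          exact (congrArg (· ⊗ₜ[A'] ψ p) h).trans (TensorProduct.zero_tmul _ _)
        map_add' := fun x y => AddMonoidHom.ext fun p => by
          have h : JetBimodule.mk d' (σ (x.1 + y.1)) (φ (x.2 + y.2)) =
              JetBimodule.mk d' (σ x.1) (φ x.2) + JetBimodule.mk d' (σ y.1) (φ y.2) :=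
            Prod.ext (map_add σ _ _) (map_add φ _ _)
          exact (congrArg (· ⊗ₜ[A'] ψ p) h).trans (TensorProduct.add_tmul _ _ _) }
      (fun f x p => by
        have h : JetBimodule.mk d' (σ (f * x.1)) (φ (f • x.2 + x.1 • d f)) =
            σ f • JetBimodule.mk d' (σ x.1) (φ x.2) := by
          refine Prod.ext (map_mul σ _ _) ?_
          change φ (f • x.2 + x.1 • d f) = σ f • φ x.2 + σ x.1 • d' (σ f)
          rw [map_add, map_smulₛₗ, map_smulₛₗ, hφ]
        refine (congrArg (· ⊗ₜ[A'] ψ p) h).trans ((TensorProduct.smul_tmul _ _ _).trans ?_)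
        exact congrArg (fun q => JetModule.mk d' (σ x.1) (φ x.2) q) (map_smulₛₗ ψ f p).symm)
  { toFun := g
    map_add' := map_add g
    map_smul' := fun f t => by
      induction t using JetModule.induction with
      | zero => rw [smul_zero]; exact (map_zero g).trans (smul_zero _).symm
      | mk a θ p =>
        change JetModule.mk d' (σ (f * a)) (φ (f • θ)) (ψ p) =
          JetModule.mk d' (σ f * σ a) (σ f • φ θ) (ψ p)
        rw [map_mul, map_smulₛₗ]
      | add x y hx hy =>
        rw [smul_add]
        refine (map_add g _ _).trans ?_
        rw [hx, hy, ← smul_add]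
        exact congrArg _ (map_add g _ _).symm }

theorem JetModule.restrict_mk (φ : Ω →ₛₗ[σ] Ω') (hφ : ∀ a, φ (d a) = d' (σ a))
    (ψ : P →ₛₗ[σ] P') (a : A) (θ : Ω) (p : P) :
    JetModule.restrict φ hφ ψ (JetModule.mk d a θ p) = JetModule.mk d' (σ a) (φ θ) (ψ p) := rfl

end Restrict

section OneForms

variable {E X : Type} [NormedAddCommGroup E] [NormedSpace ℝ E] [TopologicalSpace X]
  [ChartedSpace E X]

variable (E) in
/-- The ring `C^∞(U)` of smooth real functions on an open subset `U` of `X`. -/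
abbrev SmoothFun (U : Opens X) : Type := C^∞⟮𝓘(ℝ, E), U; 𝓘(ℝ, ℝ), ℝ⟯

/-- The extension by zero to `X` of a function on `U`; only its values near points of `U` are used. -/
def extendZero {U : Opens X} (f : SmoothFun E U) : X → ℝ :=
  Function.extend Subtype.val f 0

theorem extendZero_apply {U : Opens X} (f : SmoothFun E U) (x : U) :
    extendZero f x = f x :=
  Subtype.val_injective.extend_apply f 0 x

theorem contMDiffAt_extendZero {U : Opens X} (f : SmoothFun E U) (x : U) :
    ContMDiffAt 𝓘(ℝ, E) 𝓘(ℝ, ℝ) ∞ (extendZero f) (x : X) := by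
  rw [← contMDiffAt_subtype_iff]
  have : (fun y : U => extendZero f y) = f := funext (extendZero_apply f)
  rw [this]
  exact f.contMDiff x

theorem mdifferentiableAt_extendZero {U : Opens X} (f : SmoothFun E U) (x : U) :
    MDifferentiableAt 𝓘(ℝ, E) 𝓘(ℝ, ℝ) (extendZero f) (x : X) :=
  (contMDiffAt_extendZero f x).mdifferentiableAt (by simp)

variable (E) in
/-- The restriction homomorphism `C^∞(U) → C^∞(V)` for `V ⊆ U`. -/
abbrev smoothRestrict {U V : Opens X} (h : V ≤ U) :
    SmoothFun E U →+* SmoothFun E V :=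
  ContMDiffMap.restrictRingHom 𝓘(ℝ, E) 𝓘(ℝ, ℝ) ℝ h

variable [IsManifold 𝓘(ℝ, E) ∞ X]

/-- `θ` is smooth as a section over `U` of the cotangent bundle `T*X`. -/
def IsSmoothForm (U : Opens X) (θ : (x : U) → TangentSpace 𝓘(ℝ, E) (x : X) →L[ℝ] ℝ) : Prop :=
  ContMDiff 𝓘(ℝ, E) (𝓘(ℝ, E).prod 𝓘(ℝ, E →L[ℝ] ℝ)) ∞
    (fun x : U => (TotalSpace.mk' (E →L[ℝ] ℝ) (x : X) (θ x) :
      TotalSpace (E →L[ℝ] ℝ) (fun y : X => TangentSpace 𝓘(ℝ, E) y →L[ℝ] ℝ)))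

theorem isSmoothForm_iff {U : Opens X} {θ : (x : U) → TangentSpace 𝓘(ℝ, E) (x : X) →L[ℝ] ℝ} :
    IsSmoothForm U θ ↔ ∀ x₀ : U, ContMDiffAt 𝓘(ℝ, E) 𝓘(ℝ, E →L[ℝ] ℝ) ∞
      (fun x : U => (trivializationAt (E →L[ℝ] ℝ)
        (fun y : X => TangentSpace 𝓘(ℝ, E) y →L[ℝ] ℝ) (x₀ : X) ⟨(x : X), θ x⟩).2) x₀ := by
  refine forall_congr' fun x₀ => ?_
  rw [contMDiffAt_totalSpace]
  exact and_iff_right (contMDiff_subtype_val x₀)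

theorem eventually_mem_baseSet {U : Opens X} (x₀ : U) :
    ∀ᶠ x : U in nhds x₀, (x : X) ∈ (trivializationAt (E →L[ℝ] ℝ)
        (fun y : X => TangentSpace 𝓘(ℝ, E) y →L[ℝ] ℝ) (x₀ : X)).baseSet :=
  continuous_subtype_val.continuousAt.eventually_mem
    ((trivializationAt (E →L[ℝ] ℝ) (fun y : X => TangentSpace 𝓘(ℝ, E) y →L[ℝ] ℝ)
      (x₀ : X)).open_baseSet.mem_nhds (FiberBundle.mem_baseSet_trivializationAt' (x₀ : X)))

variable (E) in
/-- The smooth differential one-forms on the open set `U`. -/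
def OneForm (U : Opens X) : Type :=
  { θ : (x : U) → TangentSpace 𝓘(ℝ, E) (x : X) →L[ℝ] ℝ // IsSmoothForm U θ }

theorem IsSmoothForm.add {U : Opens X} {θ η : (x : U) → TangentSpace 𝓘(ℝ, E) (x : X) →L[ℝ] ℝ}
    (hθ : IsSmoothForm U θ) (hη : IsSmoothForm U η) : IsSmoothForm U (θ + η) := by
  rw [isSmoothForm_iff] at *
  intro x₀
  refine ((hθ x₀).add (hη x₀)).congr_of_eventuallyEq ?_
  filter_upwards [eventually_mem_baseSet (E := E) x₀] with x hx
  exact ((trivializationAt (E →L[ℝ] ℝ) (fun y : X => TangentSpace 𝓘(ℝ, E) y →L[ℝ] ℝ)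
      (x₀ : X)).linear ℝ hx).1 _ _

theorem IsSmoothForm.smul {U : Opens X} {θ : (x : U) → TangentSpace 𝓘(ℝ, E) (x : X) →L[ℝ] ℝ}
    (f : SmoothFun E U) (hθ : IsSmoothForm U θ) : IsSmoothForm U (fun x => f x • θ x) := by
  rw [isSmoothForm_iff] at *
  intro x₀
  refine ((f.contMDiff x₀).smul (hθ x₀)).congr_of_eventuallyEq ?_
  filter_upwards [eventually_mem_baseSet (E := E) x₀] with x hx
  exact ((trivializationAt (E →L[ℝ] ℝ) (fun y : X => TangentSpace 𝓘(ℝ, E) y →L[ℝ] ℝ)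
      (x₀ : X)).linear ℝ hx).2 _ _

theorem IsSmoothForm.zero (U : Opens X) :
    IsSmoothForm U (0 : (x : U) → TangentSpace 𝓘(ℝ, E) (x : X) →L[ℝ] ℝ) := by
  rw [isSmoothForm_iff]
  intro x₀
  refine (contMDiffAt_const (c := (0 : E →L[ℝ] ℝ))).congr_of_eventuallyEq ?_
  filter_upwards [eventually_mem_baseSet (E := E) x₀] with x hx
  exact ((trivializationAt (E →L[ℝ] ℝ) (fun y : X => TangentSpace 𝓘(ℝ, E) y →L[ℝ] ℝ)
      (x₀ : X)).linear ℝ hx).map_zero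

theorem IsSmoothForm.neg {U : Opens X} {θ : (x : U) → TangentSpace 𝓘(ℝ, E) (x : X) →L[ℝ] ℝ}
    (hθ : IsSmoothForm U θ) : IsSmoothForm U (-θ) := by
  have h := hθ.smul (-1 : SmoothFun E U)
  have e : (fun x => (-1 : SmoothFun E U) x • θ x) = -θ := by
    funext x
    exact neg_one_smul ℝ (θ x)
  rwa [e] at h

/-- Smooth one-forms as a subgroup of all fields of covectors. -/
def oneFormSubgroup (U : Opens X) :
    AddSubgroup ((x : U) → TangentSpace 𝓘(ℝ, E) (x : X) →L[ℝ] ℝ) where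
  carrier := {θ | IsSmoothForm U θ}
  add_mem' := IsSmoothForm.add
  zero_mem' := IsSmoothForm.zero U
  neg_mem' := IsSmoothForm.neg

instance (U : Opens X) : AddCommGroup (OneForm E U) :=
  inferInstanceAs (AddCommGroup (oneFormSubgroup (E := E) U))

/-- Pointwise multiplication of one-forms by smooth functions. -/
instance (U : Opens X) : Module (SmoothFun E U) (OneForm E U) where
  smul f θ := ⟨fun x => f x • θ.1 x, θ.2.smul f⟩
  one_smul θ := Subtype.ext (funext fun x => one_smul ℝ (θ.1 x))
  mul_smul f g θ := Subtype.ext (funext fun x => mul_smul (f x) (g x) (θ.1 x))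
  smul_zero f := Subtype.ext (funext fun x => smul_zero (f x))
  smul_add f θ η := Subtype.ext (funext fun x => smul_add (f x) (θ.1 x) (η.1 x))
  add_smul f g θ := Subtype.ext (funext fun x => add_smul (f x) (g x) (θ.1 x))
  zero_smul θ := Subtype.ext (funext fun x => zero_smul ℝ (θ.1 x))

/-- The differential at `x ∈ U` of a smooth function on `U`. -/
def dAt {U : Opens X} (f : SmoothFun E U) (x : U) :
    TangentSpace 𝓘(ℝ, E) (x : X) →L[ℝ] ℝ :=
  mfderiv 𝓘(ℝ, E) 𝓘(ℝ, ℝ) (extendZero f) (x : X)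

theorem isSmoothForm_dAt {U : Opens X} (f : SmoothFun E U) : IsSmoothForm U (dAt f) := by
  intro x₀
  have h : ContMDiffAt 𝓘(ℝ, E) (𝓘(ℝ, E).prod 𝓘(ℝ, E →L[ℝ] ℝ)) ∞
      (fun x : X => (TotalSpace.mk' (E →L[ℝ] ℝ) x (mfderiv 𝓘(ℝ, E) 𝓘(ℝ, ℝ) (extendZero f) x) :
        TotalSpace (E →L[ℝ] ℝ) (fun y : X => TangentSpace 𝓘(ℝ, E) y →L[ℝ] ℝ))) (x₀ : X) := by
    rw [contMDiffAt_hom_bundle]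
    refine ⟨contMDiffAt_id, ?_⟩
    have h2 := (contMDiffAt_extendZero f x₀).mfderiv_const (m := ∞) (by simp)
    refine h2.congr_of_eventuallyEq (Filter.Eventually.of_forall fun x => ?_)
    simp only [inTangentCoordinates, ContinuousLinearMap.inCoordinates, id_eq,
      TangentBundle.continuousLinearMapAt_model_space]
    exact congrArg (fun g : ℝ →L[ℝ] ℝ => g.comp _)
      (Bundle.Trivial.continuousLinearMapAt_trivialization ℝ X ℝ x)
  exact h.comp x₀ (contMDiff_subtype_val x₀)

/-- The exterior differential `d : C^∞(U) → 𝒪¹(U)`, as a derivation. -/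
def exteriorD (U : Opens X) : Derivation ℤ (SmoothFun E U) (OneForm E U) :=
  Derivation.mk'
    (AddMonoidHom.toIntLinearMap
      { toFun := fun f => ⟨dAt f, isSmoothForm_dAt f⟩
        map_zero' := Subtype.ext (funext fun x => by
          have h : extendZero (0 : SmoothFun E U) = fun _ => (0 : ℝ) := by
            funext y
            by_cases hy : y ∈ U
            · exact extendZero_apply (0 : SmoothFun E U) ⟨y, hy⟩
            · exact Function.extend_apply' _ _ _ (fun ⟨z, hz⟩ => hy (hz ▸ z.2))
          change mfderiv 𝓘(ℝ, E) 𝓘(ℝ, ℝ) (extendZero 0) (x : X) = 0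
          rw [h]
          exact mfderiv_const)
        map_add' := fun f g => Subtype.ext (funext fun x => by
          have h : extendZero (f + g) =ᶠ[nhds (x : X)] extendZero f + extendZero g := by
            filter_upwards [U.2.mem_nhds x.2] with y hy
            have := extendZero_apply (f + g) ⟨y, hy⟩
            rw [Pi.add_apply, this, extendZero_apply f ⟨y, hy⟩, extendZero_apply g ⟨y, hy⟩]
            rfl
          change mfderiv 𝓘(ℝ, E) 𝓘(ℝ, ℝ) (extendZero (f + g)) (x : X) = dAt f x + dAt g x
          rw [h.mfderiv_eq]
          exact mfderiv_add (mdifferentiableAt_extendZero f x)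
            (mdifferentiableAt_extendZero g x)) })
    (fun f g => Subtype.ext (funext fun x => by
      have h : extendZero (f * g) =ᶠ[nhds (x : X)] extendZero f * extendZero g := by
        filter_upwards [U.2.mem_nhds x.2] with y hy
        have := extendZero_apply (f * g) ⟨y, hy⟩
        rw [Pi.mul_apply, this, extendZero_apply f ⟨y, hy⟩, extendZero_apply g ⟨y, hy⟩]
        rfl
      change mfderiv 𝓘(ℝ, E) 𝓘(ℝ, ℝ) (extendZero (f * g)) (x : X) = f x • dAt g x + g x • dAt f x
      rw [h.mfderiv_eq, ← extendZero_apply f x, ← extendZero_apply g x]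
      exact ((mdifferentiableAt_extendZero f x).hasMFDerivAt.mul
        (mdifferentiableAt_extendZero g x).hasMFDerivAt).mfderiv))

theorem exteriorD_apply {U : Opens X} (f : SmoothFun E U) (x : U) :
    (exteriorD U f).1 x = mfderiv 𝓘(ℝ, E) 𝓘(ℝ, ℝ) (extendZero f) (x : X) := rfl

/-- Restriction of one-forms to a smaller open set. -/
def OneForm.restrict {U V : Opens X} (h : V ≤ U) :
    OneForm E U →ₛₗ[smoothRestrict E h]
      OneForm E V where
  toFun θ := ⟨fun x => θ.1 (Set.inclusion h x), θ.2.comp (contMDiff_inclusion h)⟩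
  map_add' _ _ := rfl
  map_smul' _ _ := rfl

theorem OneForm.restrict_exteriorD {U V : Opens X} (h : V ≤ U) (f : SmoothFun E U) :
    OneForm.restrict h (exteriorD U f) =
      exteriorD V (smoothRestrict E h f) := by
  refine Subtype.ext (funext fun x => ?_)
  change mfderiv 𝓘(ℝ, E) 𝓘(ℝ, ℝ) (extendZero f) (x : X) = mfderiv 𝓘(ℝ, E) 𝓘(ℝ, ℝ)
    (extendZero (smoothRestrict E h f)) (x : X)
  refine Filter.EventuallyEq.mfderiv_eq ?_
  filter_upwards [V.2.mem_nhds x.2] with y hy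
  rw [extendZero_apply f ⟨y, h hy⟩, extendZero_apply _ (⟨y, hy⟩ : V)]
  rfl

end OneForms


section Sheaves

variable (E X : Type) [NormedAddCommGroup E] [NormedSpace ℝ E] [TopologicalSpace X]
  [ChartedSpace E X]

/-- The sheaf of rings `C^∞_X`. -/
abbrev smoothRingSheaf : Sheaf (Opens.grothendieckTopology (TopCat.of X)) RingCat.{0} :=
  (sheafCompose _ (forget₂ CommRingCat RingCat)).obj (smoothSheafCommRing 𝓘(ℝ, E) 𝓘(ℝ, ℝ) X ℝ)

variable {E X}

instance (P : PresheafOfModules.{0} (smoothRingSheaf E X).obj) (U : Opens X) :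
    Module (SmoothFun E U) (P.obj (op U)) := (P.obj (op U)).isModule

instance (P : PresheafOfModules.{0} (smoothRingSheaf E X).obj)
    (U : (Opens (TopCat.of X))ᵒᵖ) :
    Module (SmoothFun E (X := X) U.unop) (P.obj U) := (P.obj U).isModule

variable [IsManifold 𝓘(ℝ, E) ∞ X]

instance (U : (Opens (TopCat.of X))ᵒᵖ) :
    Module ((smoothRingSheaf E X).obj.obj U) (OneForm E (X := X) U.unop) :=
  inferInstanceAs (Module (SmoothFun E (X := X) U.unop) (OneForm E (X := X) U.unop))

variable (E X) in
/-- The one-forms `𝒪¹_X` as a `C^∞_X`-module. -/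
def oneFormPresheaf : PresheafOfModules.{0} (smoothRingSheaf E X).obj where
  obj U := ModuleCat.of ((smoothRingSheaf E X).obj.obj U) (OneForm E (X := X) U.unop)
  map {U V} i := ModuleCat.ofHom
    (Y := (ModuleCat.restrictScalars ((smoothRingSheaf E X).obj.map i).hom).obj
      (ModuleCat.of ((smoothRingSheaf E X).obj.obj V) (OneForm E (X := X) V.unop)))
    { toFun := OneForm.restrict (leOfHom i.unop)
      map_add' := map_add (OneForm.restrict (E := E) (leOfHom i.unop))
      map_smul' := fun f θ => map_smulₛₗ (OneForm.restrict (E := E) (leOfHom i.unop)) f θ }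
  map_id _ := rfl
  map_comp _ _ := rfl

variable (P : PresheafOfModules.{0} (smoothRingSheaf E X).obj)

instance (U : (Opens (TopCat.of X))ᵒᵖ) :
    Module ((smoothRingSheaf E X).obj.obj U)
      (JetModule (exteriorD (E := E) (X := X) U.unop) (P.obj U)) :=
  inferInstanceAs (Module (SmoothFun E (X := X) U.unop)
    (JetModule (exteriorD (E := E) (X := X) U.unop) (P.obj U)))

/-- The restriction maps `𝒥¹(P(U)) → 𝒥¹(P(V))`. -/
def jetRestrict {U V : (Opens (TopCat.of X))ᵒᵖ} (i : U ⟶ V) :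
    JetModule (exteriorD (E := E) (X := X) U.unop) (P.obj U)
      →ₛₗ[smoothRestrict E (X := X) (leOfHom i.unop)]
    JetModule (exteriorD (E := E) (X := X) V.unop) (P.obj V) :=
  JetModule.restrict (OneForm.restrict (leOfHom i.unop))
    (OneForm.restrict_exteriorD (leOfHom i.unop)) (P.restrictₛₗ i)

/-- The presheaf `U ↦ 𝒥¹(P(U)) = (C^∞(U) ⊕ 𝒪¹(U)) ⊗ P(U)`. -/
def jetPresheaf : PresheafOfModules.{0} (smoothRingSheaf E X).obj where
  obj U := ModuleCat.of ((smoothRingSheaf E X).obj.obj U)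
    (JetModule (exteriorD (E := E) (X := X) U.unop) (P.obj U))
  map {U V} i := ModuleCat.ofHom
    (Y := (ModuleCat.restrictScalars ((smoothRingSheaf E X).obj.map i).hom).obj
      (ModuleCat.of ((smoothRingSheaf E X).obj.obj V)
        (JetModule (exteriorD (E := E) (X := X) V.unop) (P.obj V))))
    { toFun := jetRestrict P i
      map_add' := map_add (jetRestrict P i)
      map_smul' := fun f t => map_smulₛₗ (jetRestrict P i) f t }
  map_id U := by
    ext t
    change jetRestrict P (𝟙 U) t = t
    induction t using JetModule.induction with
    | zero => exact map_zero _
    | mk a θ p =>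
      refine (JetModule.restrict_mk _ _ _ a θ p).trans ?_
      have h : P.map (𝟙 U) p = p := by rw [P.map_id]; rfl
      exact congrArg (JetModule.mk _ a θ) h
    | add x y hx hy => rw [map_add, hx, hy]
  map_comp {U V W} i j := by
    ext t
    change jetRestrict P (i ≫ j) t = jetRestrict P j (jetRestrict P i t)
    induction t using JetModule.induction with
    | zero => rw [map_zero, map_zero, map_zero]
    | mk a θ p =>
      refine (JetModule.restrict_mk _ _ _ a θ p).trans ?_
      refine Eq.trans ?_ (JetModule.restrict_mk _ _ _ _ _ _).symm
      exact congrArg (JetModule.mk _ _ _) (P.map_comp_apply i j p)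
    | add x y hx hy => rw [map_add, map_add, map_add, hx, hy]

/-- The presheaf `U ↦ 𝒪¹(U) ⊗ P(U)`. -/
def formTensorPresheaf : PresheafOfModules.{0} (smoothRingSheaf E X).obj :=
  PresheafOfModules.Monoidal.tensorObj
    (R := (smoothSheafCommRing 𝓘(ℝ, E) 𝓘(ℝ, ℝ) X ℝ).obj) (oneFormPresheaf E X) P

/-- The inclusions `𝒪¹(U) ⊗ P(U) → 𝒥¹(P(U))`. -/
def jetInclPresheaf : formTensorPresheaf P ⟶ jetPresheaf P where
  app U := ModuleCat.ofHom (R := (smoothRingSheaf E X).obj.obj U)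
    (X := (formTensorPresheaf P).obj U) (Y := (jetPresheaf P).obj U)
    (jetIncl (exteriorD (E := E) (X := X) U.unop) (P.obj U))
  naturality {U V} i := by
    refine ModuleCat.hom_ext (LinearMap.ext fun t => ?_)
    let F : OneForm E (X := X) U.unop ⊗[SmoothFun E (X := X) U.unop] P.obj U →+
        JetModule (exteriorD (E := E) (X := X) V.unop) (P.obj V) :=
      (jetIncl (exteriorD (E := E) (X := X) V.unop) (P.obj V)).toAddMonoidHom.comp
        ((formTensorPresheaf P).map i).hom.toAddMonoidHom
    let G : OneForm E (X := X) U.unop ⊗[SmoothFun E (X := X) U.unop] P.obj U →+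
        JetModule (exteriorD (E := E) (X := X) V.unop) (P.obj V) :=
      (jetRestrict P i).toAddMonoidHom.comp
        (jetIncl (exteriorD (E := E) (X := X) U.unop) (P.obj U)).toAddMonoidHom
    exact TensorProduct.induction_on (motive := fun t => F t = G t) t
      ((map_zero F).trans (map_zero G).symm)
      (fun θ p => congrArg (fun a => JetModule.mk (exteriorD (E := E) (X := X) V.unop) a
        (OneForm.restrict (leOfHom i.unop) θ) (P.restrictₛₗ i p))
        (map_zero (smoothRestrict E (X := X) (leOfHom i.unop))).symm)
      (fun x y hx hy => by rw [map_add, map_add, hx, hy])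

/-- The projections `𝒥¹(P(U)) → P(U)`. -/
def jetProjPresheaf : jetPresheaf P ⟶ P where
  app U := ModuleCat.ofHom (R := (smoothRingSheaf E X).obj.obj U)
    (X := (jetPresheaf P).obj U) (Y := P.obj U)
    (jetProj (exteriorD (E := E) (X := X) U.unop) (P.obj U))
  naturality {U V} i := by
    refine ModuleCat.hom_ext (LinearMap.ext fun t => ?_)
    change jetProj (exteriorD (E := E) (X := X) V.unop) (P.obj V) (jetRestrict P i t) =
      P.map i (jetProj (exteriorD (E := E) (X := X) U.unop) (P.obj U) t)
    induction t using JetModule.induction with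
    | zero => simp only [map_zero]; rfl
    | mk a θ p => exact (P.map_smul i a p).symm
    | add x y hx hy => simp only [map_add, hx, hy]; rfl

theorem jetInclPresheaf_comp_jetProjPresheaf : jetInclPresheaf P ≫ jetProjPresheaf P = 0 := by
  refine PresheafOfModules.hom_ext fun U => ModuleCat.hom_ext ?_
  exact jetProj_comp_jetIncl (exteriorD (E := E) (X := X) U.unop) (P.obj U)

variable (E X) in
/-- The associated sheaf of `C^∞_X`-modules. -/
abbrev sheafify : PresheafOfModules.{0} (smoothRingSheaf E X).obj ⥤
    SheafOfModules.{0} (smoothRingSheaf E X) :=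
  PresheafOfModules.sheafification (𝟙 (smoothRingSheaf E X).obj)

/-- The canonical map `P(U) → P⁺(U)` to the sections of the associated sheaf. -/
def toSheafify (U : Opens X) : P.obj (op U) →ₗ[SmoothFun E U]
    ((sheafify E X).obj P).val.obj (op U) :=
  (((PresheafOfModules.sheafificationAdjunction (𝟙 (smoothRingSheaf E X).obj)).unit.app P).app
    (op U)).hom

variable (P : SheafOfModules.{0} (smoothRingSheaf E X))

/-- The sheaf `𝒪¹_X ⊗ P` of `C^∞_X`-modules. -/
def formTensor : SheafOfModules.{0} (smoothRingSheaf E X) :=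
  (sheafify E X).obj (formTensorPresheaf P.val)

/-- The jet sheaf `𝔍¹P = (C^∞_X ⊕ 𝒪¹_X) ⊗ P` of `P`. -/
def jetSheaf : SheafOfModules.{0} (smoothRingSheaf E X) :=
  (sheafify E X).obj (jetPresheaf P.val)

/-- The inclusion `𝒪¹_X ⊗ P → 𝔍¹P` of sheaves. -/
def jetSheafIncl : formTensor P ⟶ jetSheaf P := (sheafify E X).map (jetInclPresheaf P.val)

/-- The projection `𝔍¹P → P` of sheaves. -/
def jetSheafProj : jetSheaf P ⟶ P :=
  ((PresheafOfModules.sheafificationAdjunction (𝟙 (smoothRingSheaf E X).obj)).homEquiv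
    (jetPresheaf P.val) P).symm (jetProjPresheaf P.val)

theorem jetSheafIncl_comp_jetSheafProj : jetSheafIncl P ≫ jetSheafProj P = 0 := by
  let adj := PresheafOfModules.sheafificationAdjunction (𝟙 (smoothRingSheaf E X).obj)
  let pr : jetPresheaf P.val ⟶ (SheafOfModules.forget (smoothRingSheaf E X) ⋙
    PresheafOfModules.restrictScalars (𝟙 (smoothRingSheaf E X).obj)).obj P := jetProjPresheaf P.val
  have hz : jetInclPresheaf P.val ≫ pr = 0 := jetInclPresheaf_comp_jetProjPresheaf P.val
  have h := adj.homEquiv_naturality_left_symm (jetInclPresheaf P.val) pr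
  rw [hz] at h
  have h0 : (adj.homEquiv (formTensorPresheaf P.val) P).symm 0 = 0 := by
    rw [Equiv.symm_apply_eq, adj.homEquiv_unit]
    rfl
  exact h.symm.trans h0

/-- The jet sequence `0 → 𝒪¹_X ⊗ P → (C^∞_X ⊕ 𝒪¹_X) ⊗ P → P → 0` of sheaves of
`C^∞_X`-modules.  A connection on `P` is a splitting of it. -/
def jetSheafSequence : ShortComplex (SheafOfModules.{0} (smoothRingSheaf E X)) where
  X₁ := formTensor P
  X₂ := jetSheaf P
  X₃ := P
  f := jetSheafIncl P
  g := jetSheafProj P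
  zero := jetSheafIncl_comp_jetSheafProj P

/-- The section `θ ⊗ s` of `𝒪¹_X ⊗ P` over `U`. -/
def formTensor.tmul {U : Opens X} (θ : OneForm E U) (s : P.val.obj (op U)) :
    (formTensor P).val.obj (op U) :=
  toSheafify (formTensorPresheaf P.val) U
    (θ ⊗ₜ[SmoothFun E U] s : OneForm E U ⊗[SmoothFun E U] P.val.obj (op U))

/-- A Koszul connection on the sheaf `P`: a morphism of sheaves of abelian groups
`∇ : P → 𝒪¹_X ⊗ P` with `∇ (f s) = d f ⊗ s + f ∇ s`. It is `ℝ`-linear, since `d` vanishes on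
constants. -/
structure SheafKoszulConnection where
  /-- the covariant differential on sections over `U` -/
  nabla (U : Opens X) : P.val.obj (op U) →+ (formTensor P).val.obj (op U)
  nabla_restrict {U V : Opens X} (i : V ⟶ U) (s : P.val.obj (op U)) :
    nabla V (P.val.restrictₛₗ (Quiver.Hom.op i) s) =
      (formTensor P).val.restrictₛₗ (Quiver.Hom.op i) (nabla U s)
  leibniz {U : Opens X} (f : SmoothFun E U) (s : P.val.obj (op U)) :
    nabla U (f • s) = formTensor.tmul P (exteriorD U f) s + f • nabla U s

variable (E X) in
/-- A `C^∞(X)`-module is locally free if it is the module `P(X)` of global sections of a locally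
free sheaf `P` of `C^∞_X`-modules. -/
def IsLocallyFreeModule (Q : Type) [AddCommGroup Q] [Module (SmoothFun E (⊤ : Opens X)) Q] : Prop :=
  ∃ P : SheafOfModules.{0} (smoothRingSheaf E X), P.IsLocallyFree ∧
    Nonempty (Q ≃ₗ[SmoothFun E (⊤ : Opens X)] P.val.obj (op (⊤ : Opens X)))

end Sheaves
end SmoothJets

end

open SmoothJets

/-! For sheaves the argument is local existence plus a partition of unity. Over an open set with a
local basis `e`, a section is locally a finite combination `∑ c a • e a` with unique coefficients,
and `∑ d (c a) ⊗ e a` defines a flat connection (`IsLocalBasis.nonempty_connectionOn`). If `∇ i` are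
connections over the members of a cover and `ρ` is a subordinate partition of unity, then `∑ ρ i • ∇
i` satisfies the Leibniz rule because `∑ ρ i = 1` (`ConnectionOn.nonempty_top_of_partition`). The
rank may be infinite, so a section need not be a finite combination of the basis on all of its
domain. Both constructions are therefore stated as local relations between `s` and `∇ s`, and the
values are glued by `ConnectionOn.nonempty_of_relation`.

For modules there is one more obstacle: on global sections `∇` takes values in the sections of the
associated sheaf of `𝒪¹ ⊗ P`, not in the algebraic tensor product `𝒪¹(X) ⊗ P(X)`. It is overcome by
finitely many one-forms `η k` and smooth vector fields `v k` with `θ = ∑ θ(v k) η k` for every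
covector `θ` (`exists_finite_frame`). Contracting `∇` with `v k` gives operators `D k` on `P(X)`,
and `p ↦ ∑ η k ⊗ D k p` is the required connection.

The frame comes from an immersion of `X` into some `ℝ^N` (`exists_immersion`): the `η k` are the
differentials of its components, and the `v k` are dual to them under the Gram form `∑ η j ⊗ η j`, a
Riemannian metric. As `X` may be noncompact, `N` is kept finite by projecting immersions of compact
shells generically to dimension `2 dim X` and by distributing the shells over three colours.

In both cases a Koszul connection splits the jet sequence: the retraction is `(a + θ) ⊗ p ↦ θ ⊗ p +
a ∇ p` and the section is `p ↦ 1 ⊗ p - ∇ p`. -/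

noncomputable section

namespace SmoothJets

universe u

/-! ### Koszul connections and splittings over a commutative ring. -/

section Algebra

variable {A Ω : Type u} [CommRing A] [AddCommGroup Ω] [Module A Ω] {d : Derivation ℤ A Ω}
  {P P' : Type u} [AddCommGroup P] [Module A P] [AddCommGroup P'] [Module A P']

/-- Two additive maps out of a jet module agree if they agree on the elements `(a + θ) ⊗ p`. -/
theorem JetModule.addHom_ext {B : Type*} [AddCommGroup B] {f g : JetModule d P →+ B}
    (h : ∀ a θ p, f (JetModule.mk d a θ p) = g (JetModule.mk d a θ p)) : f = g := by
  ext t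
  induction t using JetModule.induction with
  | zero => rw [map_zero, map_zero]
  | mk a θ p => exact h a θ p
  | add x y hx hy => rw [map_add, map_add, hx, hy]

theorem JetModule.mk_add_mk (a b : A) (θ η : Ω) (p : P) :
    JetModule.mk d a θ p + JetModule.mk d b η p = JetModule.mk d (a + b) (θ + η) p :=
  (TensorProduct.add_tmul (JetBimodule.mk d a θ) (JetBimodule.mk d b η) p).symm

theorem JetModule.mk_add (a : A) (θ : Ω) (p q : P) :
    JetModule.mk d a θ (p + q) = JetModule.mk d a θ p + JetModule.mk d a θ q :=
  TensorProduct.tmul_add _ _ _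

/-- The scalar crosses the tensor sign into the right structure, where `f • 1 = f + d f`. Hence `p ↦
1 ⊗ p` fails to be linear by exactly the Leibniz term, which subtracting a connection removes. -/
theorem JetModule.mk_one_smul (f : A) (p : P) :
    JetModule.mk d 1 0 (f • p) = f • JetModule.mk d 1 0 p + JetModule.mk d 0 (d f) p := by
  rw [JetModule.smul_mk, JetModule.mk_add_mk]
  refine (TensorProduct.smul_tmul (R := A) f (JetBimodule.mk d 1 0) p).symm.trans ?_
  refine congrArg (· ⊗ₜ[A] p) (Prod.ext ?_ ?_)
  · exact (add_zero _).symm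
  · exact congrArg (f • (0 : Ω) + ·) (one_smul A (d f))

/-- The linear map `𝒥¹(P) → N`, `(a + θ) ⊗ p ↦ m (θ ⊗ p) + a ∇ p`, given by a first order operator
`∇ : P → N` with symbol `m`. -/
def JetModule.liftOfLeibniz {N : Type u} [AddCommGroup N] [Module A N] (m : Ω ⊗[A] P →ₗ[A] N)
    (D : P →+ N) (hD : ∀ (a : A) (p : P), D (a • p) = m (d a ⊗ₜ p) + a • D p) :
    JetModule d P →ₗ[A] N :=
  let g : JetBimodule d ⊗[A] P →+ N :=
    TensorProduct.liftAddHom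
      { toFun := fun x =>
          { toFun := fun p => m (x.2 ⊗ₜ p) + x.1 • D p
            map_zero' := by rw [tmul_zero, map_zero, map_zero, smul_zero, add_zero]
            map_add' := fun p q => by rw [tmul_add, map_add, map_add, smul_add]; abel }
        map_zero' := AddMonoidHom.ext fun p =>
          (congrArg₂ (· + ·) ((congrArg m (zero_tmul _ p)).trans (map_zero m))
            (zero_smul A (D p))).trans (add_zero _)
        map_add' := fun x y => AddMonoidHom.ext fun p => by
          change m ((x.2 + y.2) ⊗ₜ p) + (x.1 + y.1) • D p =
            (m (x.2 ⊗ₜ p) + x.1 • D p) + (m (y.2 ⊗ₜ p) + y.1 • D p)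
          rw [add_tmul, map_add, add_smul]; abel }
      -- Balancedness over the right structure: its extra term `x.1 • d f` is matched by the symbol
      -- term in the Leibniz rule for `D`.
      (fun f x p => by
        change m ((f • x.2 + x.1 • d f) ⊗ₜ p) + (f * x.1) • D p =
          m (x.2 ⊗ₜ (f • p)) + x.1 • D (f • p)
        rw [hD, add_tmul, map_add, smul_add, smul_smul, mul_comm x.1 f, ← map_smul m x.1,
          smul_tmul', smul_tmul]
        abel)
  { toFun := g
    map_add' := map_add g
    map_smul' := fun f t => by
      induction t using JetModule.induction with
      | zero => rw [smul_zero]; exact (map_zero g).trans (smul_zero _).symm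
      | mk a θ p =>
        change m ((f • θ) ⊗ₜ p) + (f * a) • D p = f • (m (θ ⊗ₜ p) + a • D p)
        rw [smul_add, smul_smul, ← map_smul m, smul_tmul']
      | add x y hx hy =>
        rw [smul_add]
        refine (map_add g _ _).trans ?_
        rw [hx, hy, ← smul_add]
        exact congrArg _ (map_add g _ _).symm }

theorem JetModule.liftOfLeibniz_mk {N : Type u} [AddCommGroup N] [Module A N]
    (m : Ω ⊗[A] P →ₗ[A] N) (D : P →+ N)
    (hD : ∀ (a : A) (p : P), D (a • p) = m (d a ⊗ₜ p) + a • D p) (a : A) (θ : Ω) (p : P) :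
    JetModule.liftOfLeibniz m D hD (JetModule.mk d a θ p) = m (θ ⊗ₜ p) + a • D p := rfl

/-- The linear map `P → N`, `p ↦ j (1 ⊗ p) - D p`, given by a linear map `j : 𝒥¹(P) → N` and a first
order operator `D` with the same symbol as `p ↦ j (1 ⊗ p)`. -/
def sectionOfLeibniz {N : Type u} [AddCommGroup N] [Module A N] (j : JetModule d P →ₗ[A] N)
    (D : P →+ N) (hD : ∀ (a : A) (p : P), D (a • p) = j (JetModule.mk d 0 (d a) p) + a • D p) :
    P →ₗ[A] N where
  toFun p := j (JetModule.mk d 1 0 p) - D p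
  map_add' p q := by rw [JetModule.mk_add, map_add, map_add]; abel
  map_smul' f p := by
    rw [hD, JetModule.mk_one_smul, map_add, map_smul, RingHom.id_apply, smul_sub]; abel

/-- A Koszul connection splits the jet sequence. -/
def KoszulConnection.splitting (c : KoszulConnection d P) : (jetSequence d P).Splitting where
  r := ModuleCat.ofHom (JetModule.liftOfLeibniz LinearMap.id c.nabla c.leibniz)
  s := ModuleCat.ofHom (sectionOfLeibniz LinearMap.id
    ((jetIncl d P).toAddMonoidHom.comp c.nabla) (fun a p => by
      change jetIncl d P (c.nabla (a • p)) = _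
      rw [c.leibniz, map_add, map_smul]
      rfl))
  f_r := by
    refine ModuleCat.hom_ext (TensorProduct.ext' fun θ p => ?_)
    refine (JetModule.liftOfLeibniz_mk LinearMap.id c.nabla c.leibniz 0 θ p).trans ?_
    rw [zero_smul, add_zero]
    rfl
  s_g := by
    refine ModuleCat.hom_ext (LinearMap.ext fun (p : P) => ?_)
    change jetProj d P (JetModule.mk d 1 0 p - jetIncl d P (c.nabla p)) = p
    rw [map_sub, jetProj_mk, one_smul]
    have := LinearMap.congr_fun (jetProj_comp_jetIncl d P) (c.nabla p)
    rw [LinearMap.comp_apply] at this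
    rw [this, LinearMap.zero_apply, sub_zero]
  id := by
    refine ModuleCat.hom_ext (LinearMap.toAddMonoidHom_injective
      (JetModule.addHom_ext fun a θ p => ?_))
    change jetIncl d P (θ ⊗ₜ p + a • c.nabla p) +
      (JetModule.mk d 1 0 (a • p) - jetIncl d P (c.nabla (a • p))) = JetModule.mk d a θ p
    rw [c.leibniz, map_add, map_add, map_smul, jetIncl_tmul, jetIncl_tmul, JetModule.mk_one_smul,
      JetModule.smul_mk]
    have h : JetModule.mk d a θ p = JetModule.mk d 0 θ p + JetModule.mk d (a * 1) (a • 0) p := by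
      rw [JetModule.mk_add_mk, zero_add, mul_one, smul_zero, add_zero]
    rw [h]
    abel

/-- Transport of a Koszul connection along an isomorphism of modules. -/
def KoszulConnection.congr (e : P ≃ₗ[A] P') (c : KoszulConnection d P') : KoszulConnection d P where
  nabla := ((e.symm.toLinearMap.lTensor Ω).toAddMonoidHom.comp c.nabla).comp e.toLinearMap.toAddMonoidHom
  leibniz a p := by
    change e.symm.toLinearMap.lTensor Ω (c.nabla (e (a • p))) =
      d a ⊗ₜ p + a • e.symm.toLinearMap.lTensor Ω (c.nabla (e p))
    rw [map_smul, c.leibniz, map_add, map_smul, LinearMap.lTensor_tmul, LinearEquiv.coe_coe,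
      e.symm_apply_apply]

/-- If `d` is a finite combination `∑ k, v k (·) θ k`, then covariant derivatives `D k` along the
`v k` assemble to a Koszul connection. -/
def KoszulConnection.ofCovariantDerivatives {ι : Type*} [Fintype ι] (θ : ι → Ω) (v : ι → A → A)
    (hd : ∀ a, d a = ∑ k, v k a • θ k) (D : ι → P →+ P)
    (hD : ∀ k a p, D k (a • p) = v k a • p + a • D k p) : KoszulConnection d P where
  nabla := ∑ k, (TensorProduct.mk A Ω P (θ k)).toAddMonoidHom.comp (D k)
  leibniz a p := by
    simp only [AddMonoidHom.finsetSum_apply, AddMonoidHom.comp_apply, LinearMap.toAddMonoidHom_coe,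
      TensorProduct.mk_apply, hD, hd, tmul_add, Finset.sum_add_distrib, sum_tmul, Finset.smul_sum,
      tmul_smul, smul_tmul']

end Algebra

end SmoothJets

end

noncomputable section

namespace SmoothJets

/-! ### Sheaves freely generated by sections: span and coordinates. -/

section LocalBasis

universe u

variable {C : Type u} [Category.{u} C] {J : GrothendieckTopology C} {R : Sheaf J RingCat.{u}}

section Span

variable {M : SheafOfModules.{u} R} {I : Type u} (e : I → M.sections)

/-- The span over `X` of a family of sections. -/
def spanAt (X : Cᵒᵖ) : Submodule (R.obj.obj X) (M.val.obj X) :=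
  Submodule.span (R.obj.obj X) (Set.range fun a => ((e a).val X : M.val.obj X))

/-- The sieve of all `Y ⟶ X` such that `s` restricted to `Y` is in the span of the sections `e`. -/
def spanSieve {X : C} (s : M.val.obj (op X)) : Sieve X where
  arrows Y f := M.val.map f.op s ∈ spanAt e (op Y)
  downward_closed {Y Z f} hf g := by
    rw [op_comp, M.val.map_comp_apply]
    have h : spanAt e (op Y) ≤ (spanAt e (op Z)).comap (M.val.restrictₛₗ g.op) := by
      rw [spanAt, Submodule.span_le]
      rintro _ ⟨a, rfl⟩
      exact Submodule.subset_span ⟨a, ((e a).property g.op).symm⟩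
    exact h hf

/-- The sections of `M` that are locally in the span of the sections `e`. -/
def locallySpanned : M.val.Submodule where
  obj X :=
    { carrier := {s | spanSieve e (X := X.unop) s ∈ J X.unop}
      zero_mem' := J.superset_covering (fun Y f _ => by
        change M.val.map f.op 0 ∈ _
        rw [map_zero]; exact Submodule.zero_mem _) (J.top_mem _)
      add_mem' := fun {s t} hs ht => J.superset_covering (fun Y f h => by
        change M.val.map f.op (s + t) ∈ _
        rw [map_add]; exact Submodule.add_mem _ h.1 h.2) (J.intersection_covering hs ht)
      smul_mem' := fun r s hs => J.superset_covering (fun Y f h => by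
        change M.val.map f.op (r • s) ∈ _
        rw [M.val.map_smul]; exact Submodule.smul_mem _ _ h) hs }
  map {X Y} f s hs := J.superset_covering (fun Z g h => by
    change M.val.map g.op (M.val.map f s) ∈ _
    rw [← M.val.map_comp_apply]
    exact h) (J.pullback_stable f.unop hs)

/-- A subpresheaf of a sheaf is a sheaf as soon as it contains every section that lies in it
locally. Here this is transitivity of the topology: being spanned locally on a cover is being
spanned locally. -/
theorem isSheaf_locallySpanned :
    Presheaf.IsSheaf J (locallySpanned e).toPresheafOfModules.presheaf := by
  rw [Presheaf.isSheaf_iff_isSheaf_forget J _ (forget AddCommGrpCat.{u}),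
    isSheaf_iff_isSheaf_of_type]
  have hM : Presieve.IsSheaf J (M.val.presheaf ⋙ forget AddCommGrpCat.{u}) := by
    rw [← isSheaf_iff_isSheaf_of_type, ← Presheaf.isSheaf_iff_isSheaf_forget]
    exact M.isSheaf
  let G : Subfunctor (M.val.presheaf ⋙ forget AddCommGrpCat.{u}) :=
    { obj := fun X => {s | (s : M.val.obj X) ∈ (locallySpanned e).obj X}
      map := fun f _ hs => (locallySpanned e).map f hs }
  refine Presieve.isSheaf_iso J (P := G.toFunctor)
    (NatIso.ofComponents (fun X => Iso.refl _) (fun f => rfl)) ((G.isSheaf_iff hM).2 ?_)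
  intro U (s : M.val.obj U) hs
  change spanSieve e (X := U.unop) s ∈ J _
  refine J.transitive hs _ fun Y f hf => ?_
  refine J.superset_covering (fun Z g h => ?_) hf
  change M.val.map (g ≫ f).op s ∈ _
  rw [op_comp, M.val.map_comp_apply]
  exact h

end Span

variable [HasWeakSheafify J AddCommGrpCat.{u}] [J.WEqualsLocallyBijective AddCommGrpCat.{u}]
  {M : SheafOfModules.{u} R} (σ : M.GeneratingSections) [IsIso σ.π]

/-- A sheaf freely generated by sections is locally spanned by them. -/
theorem spanSieve_mem {X : C} (s : M.val.obj (op X)) : spanSieve σ.s s ∈ J X := by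
  -- The isomorphism `σ.π` from the free sheaf factors through the subsheaf `N` of locally spanned
  -- sections. Composing with its inverse factors the identity of `M` through `N`, so every section
  -- lies in `N`.
  let N : SheafOfModules.{u} R := ⟨_, isSheaf_locallySpanned σ.s⟩
  let ι : N ⟶ M := ⟨(locallySpanned σ.s).ι⟩
  let t : σ.I → N.sections := fun a => ⟨fun Y => ⟨(σ.s a).val Y, by
      refine J.superset_covering (fun Z g h => ?_) (J.top_mem _)
      exact Submodule.subset_span ⟨a, ((σ.s a).property g.op).symm⟩⟩,
    fun f => Subtype.ext ((σ.s a).property f)⟩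
  have h : N.freeHomEquiv.symm t ≫ ι = σ.π := by
    rw [SheafOfModules.freeHomEquiv_symm_comp]
    rfl
  have h2 : inv σ.π ≫ N.freeHomEquiv.symm t ≫ ι = 𝟙 M := by rw [h, IsIso.inv_hom_id]
  have h3 : ((inv σ.π ≫ N.freeHomEquiv.symm t ≫ ι).val.app (op X)) s = s := by rw [h2]; rfl
  have h4 := (((inv σ.π ≫ N.freeHomEquiv.symm t).val.app (op X)) s).2
  have h5 : (((inv σ.π ≫ N.freeHomEquiv.symm t).val.app (op X)) s).1 = s := h3
  rw [h5] at h4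
  exact h4

open Classical in
/-- A sheaf freely generated by sections has the coordinate functionals dual to these. -/
theorem exists_coordinates : ∃ κ : σ.I → (M ⟶ SheafOfModules.unit R), ∀ a b (X : Cᵒᵖ),
    (κ a).val.app X ((σ.s b).val X) = if a = b then (1 : R.obj.obj X) else 0 := by
  -- The `a`-th coordinate of the free sheaf, to be transported to `M` by the inverse of `σ.π`.
  let q (a : σ.I) : SheafOfModules.free σ.I ⟶ SheafOfModules.unit R :=
    (SheafOfModules.unit R).freeHomEquiv.symm fun b =>
      SheafOfModules.unitHomEquiv _ (if a = b then 𝟙 _ else 0)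
  refine ⟨fun a => inv σ.π ≫ q a, fun a b X => ?_⟩
  have h1 : σ.s b = SheafOfModules.sectionsMap σ.π (SheafOfModules.freeSection b) :=
    (SheafOfModules.sectionsMap_freeHomEquiv_symm_freeSection σ.s b).symm
  have h2 : SheafOfModules.sectionsMap (inv σ.π ≫ q a) (σ.s b) =
      SheafOfModules.unitHomEquiv _ (if a = b then 𝟙 _ else 0) := by
    rw [h1, ← SheafOfModules.sectionsMap_comp, IsIso.hom_inv_id_assoc]
    exact SheafOfModules.sectionsMap_freeHomEquiv_symm_freeSection _ b
  refine (congrArg (fun z => z.val X) h2).trans ?_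
  split_ifs <;> rfl

end LocalBasis

end SmoothJets

end

noncomputable section

namespace SmoothJets

/-! ### Sections over open sets, gluing, and local bases of locally free sheaves. -/

section Restriction

variable {E X : Type} [NormedAddCommGroup E] [NormedSpace ℝ E] [TopologicalSpace X]
  [ChartedSpace E X]

/-- Restriction of sections of a sheaf of modules to a smaller open set. -/
def res (M : SheafOfModules.{0} (smoothRingSheaf E X)) {U V : Opens X} (h : V ≤ U) :
    M.val.obj (op U) →ₛₗ[smoothRestrict E h] M.val.obj (op V) where
  toFun := M.val.restrictₛₗ (homOfLE h).op
  map_add' := map_add _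
  map_smul' f s := map_smulₛₗ (M.val.restrictₛₗ (homOfLE h).op) f s

variable {M N : SheafOfModules.{0} (smoothRingSheaf E X)} {U V W : Opens X}

theorem res_res (h : V ≤ U) (h' : W ≤ V) (s : M.val.obj (op U)) :
    res M h' (res M h s) = res M (h'.trans h) s :=
  (M.val.map_comp_apply (homOfLE h).op (homOfLE h').op s).symm

/-- The map on sections over `U` of a morphism of sheaves of modules. -/
def Hom.on (φ : M ⟶ N) (U : Opens X) : M.val.obj (op U) →ₗ[SmoothFun E U] N.val.obj (op U) :=
  (φ.val.app (op U)).hom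

theorem res_hom (φ : M ⟶ N) (h : V ≤ U) (s : M.val.obj (op U)) :
    res N h (Hom.on φ U s) = Hom.on φ V (res M h s) :=
  (PresheafOfModules.naturality_apply φ.val (homOfLE h).op s).symm

theorem hom_ext_on {φ ψ : M ⟶ N} (h : ∀ (U : Opens X) s, Hom.on φ U s = Hom.on ψ U s) : φ = ψ :=
  SheafOfModules.hom_ext (PresheafOfModules.hom_ext fun U =>
    ModuleCat.hom_ext (LinearMap.ext fun s => h U.unop s))

/-- A morphism of sheaves of modules given by compatible linear maps on sections. -/
def Hom.mkOn (φ : ∀ U : Opens X, M.val.obj (op U) →ₗ[SmoothFun E U] N.val.obj (op U))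
    (hφ : ∀ {U V : Opens X} (h : V ≤ U) s, res N h (φ U s) = φ V (res M h s)) : M ⟶ N where
  val :=
    { app := fun U => ModuleCat.ofHom (R := (smoothRingSheaf E X).obj.obj U)
        (X := M.val.obj U) (Y := N.val.obj U) (φ U.unop)
      naturality := fun {U V} i => by
        refine ModuleCat.hom_ext (LinearMap.ext fun s => ?_)
        exact (hφ (leOfHom i.unop) s).symm }

theorem section_ext {s t : M.val.obj (op U)}
    (h : ∀ x ∈ U, ∃ (W : Opens X) (hW : W ≤ U), x ∈ W ∧ res M hW s = res M hW t) : s = t := by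
  let S : Sieve (C := Opens (TopCat.of X)) U :=
    { arrows := fun W f => res M (leOfHom f) s = res M (leOfHom f) t
      downward_closed := fun {Y Z f} hf g => by
        have := congrArg (res M (leOfHom g)) hf
        rwa [res_res, res_res] at this }
  have hS : S ∈ Opens.grothendieckTopology (TopCat.of X) U := by
    intro x hx
    obtain ⟨W, hW, hxW, e⟩ := h x hx
    exact ⟨W, homOfLE hW, e, hxW⟩
  exact M.isSheaf.isSeparated U S hS s t (fun Y f hf => hf)

/-- Gluing for a local relation that determines its sections uniquely. -/
theorem exists_glue (R : ∀ W : Opens X, W ≤ U → M.val.obj (op W) → Prop)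
    (hR : ∀ (W V : Opens X) (hW : W ≤ U) (hV : V ≤ W) t, R W hW t → R V (hV.trans hW) (res M hV t))
    (huniq : ∀ W hW t t', R W hW t → R W hW t' → t = t')
    (hex : ∀ x ∈ U, ∃ (W : Opens X) (hW : W ≤ U) (t : _), x ∈ W ∧ R W hW t) :
    ∃ t : M.val.obj (op U), ∀ W hW t', R W hW t' → res M hW t = t' := by
  have hM : Presieve.IsSheaf (Opens.grothendieckTopology (TopCat.of X))
      (M.val.presheaf ⋙ forget AddCommGrpCat.{0}) := by
    rw [← isSheaf_iff_isSheaf_of_type, ← Presheaf.isSheaf_iff_isSheaf_forget]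
    exact M.isSheaf
  let S : Sieve (C := Opens (TopCat.of X)) U :=
    { arrows := fun W f => ∃ t, R W (leOfHom f) t
      downward_closed := fun {Y Z f} hf g => hf.elim fun t ht => ⟨_, hR _ _ _ (leOfHom g) t ht⟩ }
  have hS : S ∈ Opens.grothendieckTopology (TopCat.of X) U := by
    intro x hx
    obtain ⟨W, hW, t, hxW, e⟩ := hex x hx
    exact ⟨W, homOfLE hW, ⟨t, e⟩, hxW⟩
  -- The local sections are chosen arbitrarily; `huniq` makes the choices agree on overlaps.
  let fam : Presieve.FamilyOfElements (M.val.presheaf ⋙ forget AddCommGrpCat.{0}) S.arrows :=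
    fun W f hf => hf.choose
  have hfam : fam.Compatible := by
    intro Y₁ Y₂ Z g₁ g₂ f₁ f₂ h₁ h₂ _
    exact huniq Z ((leOfHom g₁).trans (leOfHom f₁)) _ _
      (hR _ _ _ (leOfHom g₁) _ h₁.choose_spec) (hR _ _ _ (leOfHom g₂) _ h₂.choose_spec)
  obtain ⟨t, ht, -⟩ := hM S hS fam hfam
  refine ⟨t, fun W hW t' ht' => ?_⟩
  have hSW : S (homOfLE hW) := ⟨t', ht'⟩
  exact (ht (homOfLE hW) hSW).trans (huniq W hW _ _ hSW.choose_spec ht')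

/-- A family of sections over `U` is a local basis if it is linearly independent over all smaller
open sets and every section over a smaller open set is locally in its span. -/
structure IsLocalBasis {I : Type} (e : I → M.val.obj (op U)) : Prop where
  linearIndependent (V : Opens X) (h : V ≤ U) :
    LinearIndependent (SmoothFun E V) fun a => res M h (e a)
  span (V : Opens X) (h : V ≤ U) (s : M.val.obj (op V)) (x : X) (hx : x ∈ V) :
    ∃ (W : Opens X) (hW : W ≤ V), x ∈ W ∧ res M hW s ∈
      Submodule.span (SmoothFun E W) (Set.range fun a => res M (hW.trans h) (e a))

end Restriction

section LocalBasis

variable {E X : Type} [NormedAddCommGroup E] [NormedSpace ℝ E] [TopologicalSpace X]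
  [ChartedSpace E X]

theorem res_over_section {M : SheafOfModules.{0} (smoothRingSheaf E X)}
    {U : Opens (TopCat.of X)} (t : (M.over U).sections) (V : Opens (TopCat.of X)) (h : V ≤ U) :
    res M h (t.val (op (Over.mk (𝟙 U)))) = t.val (op (Over.mk (homOfLE h))) := by
  rw [← t.property (Over.homMk (homOfLE h) : Over.mk (homOfLE h) ⟶ Over.mk (𝟙 U)).op]
  rfl

variable {M : SheafOfModules.{0} (smoothRingSheaf E X)} {U : Opens (TopCat.of X)}
  (σ : (M.over U).GeneratingSections) [IsIso σ.π]

/-- The sections over `U` underlying generators of the restriction to `U`. -/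
def generatorOn (a : σ.I) : M.val.obj (op U) := (σ.s a).val (op (Over.mk (𝟙 U)))

/-- The coordinate functionals of `exists_coordinates`, evaluated over `V`, read off each
coefficient of a vanishing combination. -/
theorem linearIndependent_generatorOn (V : Opens X) (h : V ≤ U) :
    LinearIndependent (SmoothFun E V) fun a => res M h (generatorOn σ a) := by
  classical
  obtain ⟨κ, hκ⟩ := exists_coordinates σ
  let k (a : σ.I) : M.val.obj (op V) →ₗ[SmoothFun E V] SmoothFun E V :=
    ((κ a).val.app (op (Over.mk (Y := (V : Opens (TopCat.of X))) (homOfLE h)))).hom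
  have hk (a b : σ.I) : k a (res M h (generatorOn σ b)) = if a = b then 1 else 0 := by
    refine (congrArg (k a) (res_over_section (σ.s b) V h)).trans ((hκ a b _).trans ?_)
    split_ifs <;> rfl
  rw [linearIndependent_iff]
  intro l hl
  ext1 a
  have := congrArg (k a) hl
  rw [Finsupp.linearCombination_apply, Finsupp.sum, map_sum, map_zero] at this
  simp only [map_smul, hk, smul_eq_mul, mul_ite, mul_one, mul_zero] at this
  rw [Finset.sum_ite_eq] at this
  by_contra hne
  rw [if_pos (Finsupp.mem_support_iff.2 hne)] at this
  exact hne this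

/-- A covering sieve of `V ⟶ U` in the over site is a sieve on `V` covering each of its points,
which turns `spanSieve_mem` into a statement about neighbourhoods. -/
theorem exists_mem_span_generatorOn (V : Opens X) (h : V ≤ U) (s : M.val.obj (op V)) (x : X)
    (hx : x ∈ V) : ∃ (W : Opens X) (hW : W ≤ V), x ∈ W ∧ res M hW s ∈
      Submodule.span (SmoothFun E W) (Set.range fun a => res M (hW.trans h) (generatorOn σ a)) := by
  have hs := spanSieve_mem σ (X := Over.mk (Y := (V : Opens (TopCat.of X))) (homOfLE h)) s
  rw [GrothendieckTopology.mem_over_iff] at hs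
  obtain ⟨W, f, hf, hyW⟩ := hs x hx
  rw [Sieve.overEquiv_iff] at hf
  refine ⟨W, leOfHom f, hyW, ?_⟩
  have e : (fun a => res M ((leOfHom f).trans h) (generatorOn σ a)) = fun a =>
      (σ.s a).val (op (Over.mk (Y := (W : Opens (TopCat.of X))) (homOfLE ((leOfHom f).trans h)))) :=
    funext fun a => res_over_section (σ.s a) W ((leOfHom f).trans h)
  rw [e]
  exact hf

theorem exists_isLocalBasis (hM : M.IsLocallyFree) (x : X) :
    ∃ (U : Opens X) (I : Type) (e : I → M.val.obj (op U)), x ∈ U ∧ IsLocalBasis e := by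
  obtain ⟨q, hq⟩ := hM.exists_isLocallyFreeData
  obtain ⟨V, f, ⟨i, ⟨g⟩⟩, hxV⟩ := q.coversTop (⊤ : Opens X) x trivial
  exact ⟨q.X i, _, generatorOn (q.generators i), leOfHom g hxV,
    ⟨linearIndependent_generatorOn _, exists_mem_span_generatorOn _⟩⟩

end LocalBasis

end SmoothJets

end

noncomputable section

namespace SmoothJets

/-! ### Morphisms out of associated sheaves, and the splitting given by a sheaf connection. -/

section Sheafify

variable {E X : Type} [NormedAddCommGroup E] [NormedSpace ℝ E] [TopologicalSpace X]
  [ChartedSpace E X]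
  {Q Q' : PresheafOfModules.{0} (smoothRingSheaf E X).obj}
  {M : SheafOfModules.{0} (smoothRingSheaf E X)}

theorem sheafify_hom_ext {φ ψ : (sheafify E X).obj Q ⟶ M}
    (h : ∀ (U : Opens X) (m : Q.obj (op U)),
      Hom.on φ U (toSheafify Q U m) = Hom.on ψ U (toSheafify Q U m)) : φ = ψ := by
  let adj := PresheafOfModules.sheafificationAdjunction (𝟙 (smoothRingSheaf E X).obj)
  apply (adj.homEquiv Q M).injective
  rw [adj.homEquiv_unit, adj.homEquiv_unit]
  exact PresheafOfModules.hom_ext fun U => ModuleCat.hom_ext (LinearMap.ext fun m => h U.unop m)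

/-- The morphism out of the associated sheaf given by a morphism of presheaves. -/
def sheafifyLift (ψ : Q ⟶ M.val) : (sheafify E X).obj Q ⟶ M :=
  ((PresheafOfModules.sheafificationAdjunction (𝟙 (smoothRingSheaf E X).obj)).homEquiv Q M).symm ψ

theorem sheafifyLift_toSheafify (ψ : Q ⟶ M.val) (U : Opens X) (m : Q.obj (op U)) :
    Hom.on (sheafifyLift ψ) U (toSheafify Q U m) = ψ.app (op U) m := by
  let adj := PresheafOfModules.sheafificationAdjunction (𝟙 (smoothRingSheaf E X).obj)
  have h : adj.unit.app Q ≫ _ = ψ :=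
    (adj.homEquiv_unit Q M _).symm.trans ((adj.homEquiv Q M).apply_symm_apply ψ)
  exact congrArg (fun z => (PresheafOfModules.Hom.app z (op U)) m) h

theorem sheafify_map_toSheafify (f : Q ⟶ Q') (U : Opens X) (m : Q.obj (op U)) :
    Hom.on ((sheafify E X).map f) U (toSheafify Q U m) = toSheafify Q' U (f.app (op U) m) := by
  let adj := PresheafOfModules.sheafificationAdjunction (𝟙 (smoothRingSheaf E X).obj)
  exact congrArg (fun z => (PresheafOfModules.Hom.app z (op U)) m) (adj.unit.naturality f).symm

theorem res_toSheafify {U V : Opens X} (h : V ≤ U) (m : Q.obj (op U)) :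
    res ((sheafify E X).obj Q) h (toSheafify Q U m) = toSheafify Q V (Q.map (homOfLE h).op m) := by
  let adj := PresheafOfModules.sheafificationAdjunction (𝟙 (smoothRingSheaf E X).obj)
  exact (PresheafOfModules.naturality_apply (adj.unit.app Q) (homOfLE h).op m).symm

theorem Hom.on_comp {M N K : SheafOfModules.{0} (smoothRingSheaf E X)} (φ : M ⟶ N) (ψ : N ⟶ K)
    (U : Opens X) (s : M.val.obj (op U)) : Hom.on (φ ≫ ψ) U s = Hom.on ψ U (Hom.on φ U s) := rfl

variable [IsManifold 𝓘(ℝ, E) ∞ X] (P : SheafOfModules.{0} (smoothRingSheaf E X))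

theorem jetSheafProj_toSheafify (U : Opens X) (m : (jetPresheaf P.val).obj (op U)) :
    Hom.on (jetSheafProj P) U (toSheafify _ U m) =
      jetProj (exteriorD (E := E) (X := X) U) (P.val.obj (op U)) m :=
  sheafifyLift_toSheafify (jetProjPresheaf P.val) U m

theorem jetSheafIncl_toSheafify (U : Opens X) (m : (formTensorPresheaf P.val).obj (op U)) :
    Hom.on (jetSheafIncl P) U (toSheafify _ U m) = toSheafify (jetPresheaf P.val) U
      (jetIncl (exteriorD (E := E) (X := X) U) (P.val.obj (op U)) m) :=
  sheafify_map_toSheafify (jetInclPresheaf P.val) U m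

/-- Two morphisms out of `𝒪¹ ⊗ P` agree if they agree on the sections `θ ⊗ s`. -/
theorem formTensor_hom_ext {φ ψ : formTensor P ⟶ M}
    (h : ∀ (U : Opens X) (θ : OneForm E U) (s : P.val.obj (op U)),
      Hom.on φ U (formTensor.tmul P θ s) = Hom.on ψ U (formTensor.tmul P θ s)) : φ = ψ := by
  refine sheafify_hom_ext fun U m => ?_
  let F : OneForm E U ⊗[SmoothFun E U] P.val.obj (op U) →ₗ[SmoothFun E U]
    (formTensor P).val.obj (op U) := toSheafify (formTensorPresheaf P.val) U
  exact LinearMap.congr_fun (TensorProduct.ext' (g := Hom.on φ U ∘ₗ F) (h := Hom.on ψ U ∘ₗ F) (h U)) m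

theorem res_tmul {U V : Opens X} (h : V ≤ U) (θ : OneForm E U) (s : P.val.obj (op U)) :
    res (formTensor P) h (formTensor.tmul P θ s) =
      formTensor.tmul P (OneForm.restrict h θ) (res P h s) :=
  res_toSheafify h _

/-- The map `𝒪¹(U) ⊗ P(U) → (𝒪¹ ⊗ P)(U)`. -/
def tmulLin (U : Opens X) : OneForm E U ⊗[SmoothFun E U] P.val.obj (op U) →ₗ[SmoothFun E U]
    (formTensor P).val.obj (op U) := toSheafify (formTensorPresheaf P.val) U

/-- The map `𝒥¹(P(U)) → (𝔍¹P)(U)`. -/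
def jetLin (U : Opens X) :
    JetModule (exteriorD (E := E) (X := X) U) (P.val.obj (op U)) →ₗ[SmoothFun E U]
    (jetSheaf P).val.obj (op U) := toSheafify (jetPresheaf P.val) U

theorem jetSheafProj_jetLin (U : Opens X) (m) : Hom.on (jetSheafProj P) U (jetLin P U m) =
    jetProj (exteriorD (E := E) (X := X) U) (P.val.obj (op U)) m := jetSheafProj_toSheafify P U m

theorem jetSheafIncl_tmul {U : Opens X} (θ : OneForm E U) (s : P.val.obj (op U)) :
    Hom.on (jetSheafIncl P) U (formTensor.tmul P θ s) = jetLin P U (JetModule.mk _ 0 θ s) :=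
  jetSheafIncl_toSheafify P U _

/-- By adjunction a morphism out of the associated sheaf is determined on the presheaf, whose
sections are sums of elements `(a + θ) ⊗ s`. -/
theorem jetSheaf_hom_ext {φ ψ : jetSheaf P ⟶ M}
    (h : ∀ (U : Opens X) (a : SmoothFun E U) (θ : OneForm E U) (s : P.val.obj (op U)),
      Hom.on φ U (jetLin P U (JetModule.mk _ a θ s)) =
        Hom.on ψ U (jetLin P U (JetModule.mk _ a θ s))) : φ = ψ := by
  refine sheafify_hom_ext fun U m => ?_
  exact DFunLike.congr_fun (JetModule.addHom_ext (f := (Hom.on φ U ∘ₗ jetLin P U).toAddMonoidHom)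
    (g := (Hom.on ψ U ∘ₗ jetLin P U).toAddMonoidHom) (h U)) m

theorem res_jetLin_mk {U V : Opens X} (h : V ≤ U) (a : SmoothFun E U) (θ : OneForm E U)
    (s : P.val.obj (op U)) :
    res (jetSheaf P) h (jetLin P U (JetModule.mk _ a θ s)) =
      jetLin P V (JetModule.mk _ (smoothRestrict E h a) (OneForm.restrict h θ) (res P h s)) :=
  res_toSheafify h _

/-- The morphism out of `𝔍¹P` given by compatible linear maps on the `𝒥¹(P(U))`. -/
def jetSheafLift
    (φ : ∀ U : Opens X, JetModule (exteriorD (E := E) (X := X) U) (P.val.obj (op U))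
      →ₗ[SmoothFun E U] M.val.obj (op U))
    (hφ : ∀ {U V : Opens X} (h : V ≤ U) (a : SmoothFun E U) (θ : OneForm E U)
      (s : P.val.obj (op U)), res M h (φ U (JetModule.mk _ a θ s)) =
        φ V (JetModule.mk _ (smoothRestrict E h a) (OneForm.restrict h θ) (res P h s))) :
    jetSheaf P ⟶ M :=
  sheafifyLift
    { app := fun U => ModuleCat.ofHom (R := (smoothRingSheaf E X).obj.obj U)
        (X := (jetPresheaf P.val).obj U) (Y := M.val.obj U) (φ U.unop)
      naturality := fun {U V} i => by
        refine ModuleCat.hom_ext (LinearMap.ext fun t => ?_)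
        refine DFunLike.congr_fun (JetModule.addHom_ext
          (f := (φ V.unop).toAddMonoidHom.comp (jetRestrict P.val i).toAddMonoidHom)
          (g := (res M (leOfHom i.unop)).toAddMonoidHom.comp (φ U.unop).toAddMonoidHom)
          fun a θ s => ?_) t
        exact (hφ (leOfHom i.unop) a θ s).symm }

theorem jetSheafLift_jetLin
    (φ : ∀ U : Opens X, JetModule (exteriorD (E := E) (X := X) U) (P.val.obj (op U))
      →ₗ[SmoothFun E U] M.val.obj (op U)) (hφ) (U : Opens X) (m) :
    Hom.on (jetSheafLift P φ hφ) U (jetLin P U m) = φ U m :=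
  sheafifyLift_toSheafify (Q := jetPresheaf P.val) _ U m

variable {P}

theorem SheafKoszulConnection.nabla_res (c : SheafKoszulConnection P) {U V : Opens X} (h : V ≤ U)
    (s : P.val.obj (op U)) : res (formTensor P) h (c.nabla U s) = c.nabla V (res P h s) :=
  (c.nabla_restrict (homOfLE h) s).symm

/-- The retraction `𝔍¹P → 𝒪¹ ⊗ P` given by a Koszul connection. -/
def SheafKoszulConnection.retraction (c : SheafKoszulConnection P) : jetSheaf P ⟶ formTensor P :=
  jetSheafLift P (fun U => JetModule.liftOfLeibniz (tmulLin P U) (c.nabla U) c.leibniz)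
    (fun {U V} h a θ s => by
      change res (formTensor P) h (formTensor.tmul P θ s + a • c.nabla U s) =
        formTensor.tmul P (OneForm.restrict h θ) (res P h s) +
          smoothRestrict E h a • c.nabla V (res P h s)
      rw [map_add, map_smulₛₗ, c.nabla_res, res_tmul])

theorem SheafKoszulConnection.retraction_mk (c : SheafKoszulConnection P) {U : Opens X}
    (a : SmoothFun E U) (θ : OneForm E U) (s : P.val.obj (op U)) :
    Hom.on c.retraction U (jetLin P U (JetModule.mk _ a θ s)) =
      formTensor.tmul P θ s + a • c.nabla U s :=
  jetSheafLift_jetLin P _ _ U _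

/-- The section `P → 𝔍¹P` given by a Koszul connection. -/
def SheafKoszulConnection.jetSection (c : SheafKoszulConnection P) : P ⟶ jetSheaf P :=
  Hom.mkOn
    (fun U => sectionOfLeibniz (jetLin P U)
      ((Hom.on (jetSheafIncl P) U).toAddMonoidHom.comp (c.nabla U)) (fun a p => by
        change Hom.on (jetSheafIncl P) U (c.nabla U (a • p)) =
          _ + a • Hom.on (jetSheafIncl P) U (c.nabla U p)
        rw [c.leibniz, map_add, map_smul, jetSheafIncl_tmul]))
    (fun {U V} h s => by
      change res _ h (jetLin P U (JetModule.mk _ 1 0 s) - Hom.on (jetSheafIncl P) U (c.nabla U s)) =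
        jetLin P V (JetModule.mk _ 1 0 (res P h s)) -
          Hom.on (jetSheafIncl P) V (c.nabla V (res P h s))
      rw [map_sub, res_hom, c.nabla_res, res_jetLin_mk, map_one, map_zero])

theorem SheafKoszulConnection.jetSection_apply (c : SheafKoszulConnection P) {U : Opens X}
    (s : P.val.obj (op U)) : Hom.on c.jetSection U s =
      jetLin P U (JetModule.mk _ 1 0 s) - Hom.on (jetSheafIncl P) U (c.nabla U s) := rfl

/-- A Koszul connection on a sheaf splits its jet sequence. -/
def SheafKoszulConnection.splitting (c : SheafKoszulConnection P) :
    (jetSheafSequence P).Splitting where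
  r := c.retraction
  s := c.jetSection
  f_r := by
    refine formTensor_hom_ext P fun U θ s => ?_
    change Hom.on c.retraction U (Hom.on (jetSheafIncl P) U (formTensor.tmul P θ s)) =
      formTensor.tmul P θ s
    rw [jetSheafIncl_tmul, c.retraction_mk, zero_smul, add_zero]
  s_g := by
    refine hom_ext_on fun U (s : P.val.obj (op U)) => ?_
    change Hom.on (jetSheafProj P) U (Hom.on c.jetSection U s) = s
    rw [c.jetSection_apply, map_sub, jetSheafProj_jetLin, jetProj_mk, one_smul]
    have h : Hom.on (jetSheafProj P) U (Hom.on (jetSheafIncl P) U (c.nabla U s)) = 0 := by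
      rw [← Hom.on_comp, jetSheafIncl_comp_jetSheafProj]
      rfl
    rw [h, sub_zero]
  id := by
    refine jetSheaf_hom_ext P fun U a θ s => ?_
    change Hom.on (jetSheafIncl P) U (Hom.on c.retraction U (jetLin P U (JetModule.mk _ a θ s))) +
      Hom.on c.jetSection U (Hom.on (jetSheafProj P) U (jetLin P U (JetModule.mk _ a θ s))) =
        jetLin P U (JetModule.mk _ a θ s)
    rw [c.retraction_mk, jetSheafProj_jetLin, jetProj_mk, map_smul, c.jetSection_apply, map_add,
      jetSheafIncl_tmul, map_smul, smul_sub, ← map_smul (jetLin P U), JetModule.smul_mk, smul_zero,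
      mul_one]
    have h : JetModule.mk (exteriorD (E := E) U) a θ s =
        JetModule.mk _ 0 θ s + JetModule.mk _ a 0 s := by
      rw [JetModule.mk_add_mk, zero_add, add_zero]
    rw [h, map_add]
    abel

end Sheafify

end SmoothJets

end

noncomputable section

namespace SmoothJets

/-! ### Local connections and their gluing by a partition of unity. -/

section Connections

variable {E X : Type} [NormedAddCommGroup E] [NormedSpace ℝ E] [TopologicalSpace X]
  [ChartedSpace E X]
  {P : SheafOfModules.{0} (smoothRingSheaf E X)} {U : Opens X}

section Coefficients

variable {I : Type} (e : I → P.val.obj (op U))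

/-- The combination `∑ a, c a • e a` of the sections `e` over `W`. -/
def combination {W : Opens X} (h : W ≤ U) :
    (I →₀ SmoothFun E W) →ₗ[SmoothFun E W] P.val.obj (op W) :=
  Finsupp.linearCombination (SmoothFun E W) fun a => res P h (e a)

theorem combination_single {W : Opens X} (h : W ≤ U) (a : I) (f : SmoothFun E W) :
    combination e h (Finsupp.single a f) = f • res P h (e a) :=
  Finsupp.linearCombination_single _ _ _

/-- Restriction of coefficient families. -/
def resCoeff {V W : Opens X} (h : V ≤ W) : (I →₀ SmoothFun E W) →+ (I →₀ SmoothFun E V) :=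
  Finsupp.mapRange.addMonoidHom (smoothRestrict E h).toAddMonoidHom

theorem resCoeff_single {V W : Opens X} (h : V ≤ W) (a : I) (f : SmoothFun E W) :
    resCoeff h (Finsupp.single a f) = Finsupp.single a (smoothRestrict E h f) :=
  Finsupp.mapRange_single (hf := map_zero _)

theorem res_combination {V W : Opens X} (hW : W ≤ U) (h : V ≤ W) (c : I →₀ SmoothFun E W) :
    res P h (combination e hW c) = combination e (h.trans hW) (resCoeff h c) := by
  induction c using Finsupp.induction_linear with
  | zero => simp only [map_zero]
  | add c c' hc hc' => simp only [map_add, hc, hc']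
  | single a f => rw [combination_single, resCoeff_single, combination_single, map_smulₛₗ, res_res]

end Coefficients

section Partition

variable {ι : Type} {V : ι → Opens X} (ρ : SmoothPartitionOfUnity ι 𝓘(ℝ, E) X Set.univ)

/-- The restriction to `W` of a function of the partition of unity. -/
def partitionOn (i : ι) (W : Opens X) : SmoothFun E W :=
  ⟨fun x => ρ i x, (ρ i).contMDiff.comp contMDiff_subtype_val⟩

theorem partitionOn_eq_zero {i : ι} {W : Opens X} (h : ∀ x ∈ W, ρ i x = 0) :
    partitionOn ρ i W = 0 :=
  ContMDiffMap.ext fun x => h x x.2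

theorem sum_partitionOn {S : Finset ι} {W : Opens X} (h : ∀ i ∉ S, ∀ x ∈ W, ρ i x = 0) :
    ∑ i ∈ S, partitionOn ρ i W = 1 := by
  refine ContMDiffMap.ext fun x => ?_
  have h1 : (∑ i ∈ S, partitionOn ρ i W) x = ∑ i ∈ S, ρ i x := by
    change ContMDiffMap.coeFnAddMonoidHom _ x = _
    rw [map_sum, Finset.sum_apply]
    rfl
  rw [h1]
  change _ = (1 : ℝ)
  rw [← ρ.sum_eq_one (Set.mem_univ (x : X)), finsum_eq_sum_of_support_subset]
  intro i hi
  by_contra hS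
  exact hi (h i hS x x.2)

/-- By local finiteness only the finitely many `i` whose closed support contains `x` matter near
`x`. Subordination puts `x` in each of the corresponding open sets `V i`. -/
theorem exists_partition_nhds (hρ : ρ.IsSubordinate fun i => (V i : Set X)) {W : Opens X} {x : X}
    (hx : x ∈ W) : ∃ W' ≤ W, x ∈ W' ∧
      ∃ S : Finset ι, (∀ i ∈ S, W' ≤ V i) ∧ ∀ i ∉ S, ∀ y ∈ W', ρ i y = 0 := by
  have h1 := ρ.eventually_fintsupport_subset x
  have h2 : ∀ᶠ y in nhds x, ∀ i ∈ ρ.fintsupport x, y ∈ V i := by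
    rw [Finset.eventually_all]
    exact fun i hi => (V i).2.mem_nhds (hρ i ((ρ.mem_fintsupport_iff x i).1 hi))
  obtain ⟨O, hO, hOo, hxO⟩ := eventually_nhds_iff.1 (h1.and (h2.and (W.2.mem_nhds hx)))
  refine ⟨⟨O, hOo⟩, fun y hy => (hO y hy).2.2, hxO, ρ.fintsupport x,
    fun i hi y hy => (hO y hy).2.1 i hi, fun i hi y hy => ?_⟩
  by_contra hne
  exact hi ((hO y hy).1 ((ρ.mem_fintsupport_iff y i).2 (subset_tsupport _ hne)))

end Partition

variable [IsManifold 𝓘(ℝ, E) ∞ X]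

variable (P U) in
/-- A Koszul connection on the restriction of the sheaf `P` to `U`. -/
structure ConnectionOn where
  /-- the covariant differential on sections over `V` -/
  nabla (V : Opens X) (h : V ≤ U) : P.val.obj (op V) →+ (formTensor P).val.obj (op V)
  nabla_res {V W : Opens X} (hV : V ≤ U) (h : W ≤ V) (s : P.val.obj (op V)) :
    res (formTensor P) h (nabla V hV s) = nabla W (h.trans hV) (res P h s)
  leibniz {V : Opens X} (hV : V ≤ U) (f : SmoothFun E V) (s : P.val.obj (op V)) :
    nabla V hV (f • s) = formTensor.tmul P (exteriorD V f) s + f • nabla V hV s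

/-- A local relation between sections of `P` and of `𝒪¹ ⊗ P`, locally total, functional, additive and
compatible with the Leibniz rule, is the graph of a connection. -/
theorem ConnectionOn.nonempty_of_relation
    (R : ∀ W : Opens X, W ≤ U → P.val.obj (op W) → (formTensor P).val.obj (op W) → Prop)
    (hres : ∀ (W V : Opens X) (hW : W ≤ U) (hV : V ≤ W) s t, R W hW s t →
      R V (hV.trans hW) (res P hV s) (res (formTensor P) hV t))
    (huniq : ∀ W hW s t t', R W hW s t → R W hW s t' → t = t')
    (hadd : ∀ W hW s s' t t', R W hW s t → R W hW s' t' → R W hW (s + s') (t + t'))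
    (hleib : ∀ W hW (f : SmoothFun E W) s t, R W hW s t →
      R W hW (f • s) (formTensor.tmul P (exteriorD W f) s + f • t))
    (hex : ∀ (V : Opens X) (hV : V ≤ U) (s : P.val.obj (op V)), ∀ x ∈ V,
      ∃ (W : Opens X) (hW : W ≤ V) (t : _), x ∈ W ∧ R W (hW.trans hV) (res P hW s) t) :
    Nonempty (ConnectionOn P U) := by
  -- The value of the connection at `s` is glued from all local sections related to restrictions of
  -- `s`. Each identity below is then checked on neighbourhoods where the relation has a solution.
  have key (V : Opens X) (hV : V ≤ U) (s : P.val.obj (op V)) :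
      ∃ t : (formTensor P).val.obj (op V), ∀ W (hW : W ≤ V) t',
        R W (hW.trans hV) (res P hW s) t' → res (formTensor P) hW t = t' := by
    refine exists_glue (fun W hW t => R W (hW.trans hV) (res P hW s) t) ?_ ?_ (hex V hV s)
    · intro W W' hW hW' t ht
      have := hres _ _ _ hW' _ _ ht
      rwa [res_res] at this
    · exact fun W hW t t' => huniq W _ _ t t'
  choose N hN using key
  refine ⟨{ nabla := fun V hV => AddMonoidHom.mk' (N V hV) fun s s' => ?_, nabla_res := ?_,
            leibniz := ?_ }⟩
  · refine section_ext fun x hx => ?_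
    obtain ⟨W, hW, t, hxW, ht⟩ := hex V hV s x hx
    -- The solution for `s'` is sought inside `W`, so that both solutions live on the common
    -- neighbourhood `W'`.
    obtain ⟨W', hW', t', hxW', ht'⟩ := hex W (hW.trans hV) (res P hW s') x hxW
    rw [res_res] at ht'
    have h1 := hres _ _ _ hW' _ _ ht
    rw [res_res] at h1
    have h2 := hadd _ _ _ _ _ _ h1 ht'
    rw [← map_add] at h2
    refine ⟨W', hW'.trans hW, hxW', ?_⟩
    rw [map_add, hN _ _ _ _ _ _ h1, hN _ _ _ _ _ _ ht', hN _ _ _ _ _ _ h2]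
  · intro V W hV h s
    refine section_ext fun x hx => ?_
    obtain ⟨W', hW', t, hxW, ht⟩ := hex W (h.trans hV) (res P h s) x hx
    refine ⟨W', hW', hxW, ?_⟩
    refine Eq.trans ?_ (hN _ _ _ _ _ _ ht).symm
    rw [res_res] at ht
    exact (res_res _ _ _).trans (hN _ _ _ _ _ _ ht)
  · intro V hV f s
    refine section_ext fun x hx => ?_
    obtain ⟨W, hW, t, hxW, ht⟩ := hex V hV s x hx
    have h1 := hleib _ _ (smoothRestrict E hW f) _ _ ht
    rw [← map_smulₛₗ] at h1
    refine ⟨W, hW, hxW, ?_⟩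
    refine (hN _ _ _ _ _ _ h1).trans ?_
    rw [map_add, map_smulₛₗ, res_tmul, OneForm.restrict_exteriorD]
    exact congrArg (fun z => _ + smoothRestrict E hW f • z) (hN _ _ _ _ _ _ ht).symm

section Basis

variable {I : Type} (e : I → P.val.obj (op U))

/-- The section `∑ a, d (c a) ⊗ e a` of `𝒪¹ ⊗ P` over `W`. -/
def flatNabla {W : Opens X} (h : W ≤ U) :
    (I →₀ SmoothFun E W) →+ (formTensor P).val.obj (op W) :=
  Finsupp.liftAddHom fun a => (tmulLin P W).toAddMonoidHom.comp
    (((TensorProduct.mk (SmoothFun E W) (OneForm E W) (P.val.obj (op W))).flip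
      (res P h (e a))).toAddMonoidHom.comp (exteriorD (E := E) W : _ →ₗ[ℤ] _).toAddMonoidHom)

theorem flatNabla_single {W : Opens X} (h : W ≤ U) (a : I) (f : SmoothFun E W) :
    flatNabla e h (Finsupp.single a f) = formTensor.tmul P (exteriorD W f) (res P h (e a)) :=
  Finsupp.liftAddHom_apply_single _ _ _

theorem res_flatNabla {V W : Opens X} (hW : W ≤ U) (h : V ≤ W) (c : I →₀ SmoothFun E W) :
    res (formTensor P) h (flatNabla e hW c) = flatNabla e (h.trans hW) (resCoeff h c) := by
  induction c using Finsupp.induction_linear with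
  | zero => simp only [map_zero]
  | add c c' hc hc' => simp only [map_add, hc, hc']
  | single a f => rw [flatNabla_single, resCoeff_single, flatNabla_single, res_tmul, res_res,
      OneForm.restrict_exteriorD]

theorem tmul_add_left {W : Opens X} (θ η : OneForm E W) (s : P.val.obj (op W)) :
    formTensor.tmul P (θ + η) s = formTensor.tmul P θ s + formTensor.tmul P η s :=
  (congrArg (tmulLin P W) (TensorProduct.add_tmul θ η s)).trans (map_add _ _ _)

theorem tmul_add_right {W : Opens X} (θ : OneForm E W) (s t : P.val.obj (op W)) :
    formTensor.tmul P θ (s + t) = formTensor.tmul P θ s + formTensor.tmul P θ t :=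
  (congrArg (tmulLin P W) (TensorProduct.tmul_add θ s t)).trans (map_add _ _ _)

theorem tmul_zero_right {W : Opens X} (θ : OneForm E W) :
    formTensor.tmul P θ (0 : P.val.obj (op W)) = 0 :=
  (congrArg (tmulLin P W) (TensorProduct.tmul_zero _ θ)).trans (map_zero _)

theorem tmul_smul_left {W : Opens X} (f : SmoothFun E W) (θ : OneForm E W)
    (s : P.val.obj (op W)) : formTensor.tmul P (f • θ) s = f • formTensor.tmul P θ s :=
  (congrArg (tmulLin P W) (TensorProduct.smul_tmul' f θ s).symm).trans (map_smul _ _ _)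

theorem tmul_smul_right {W : Opens X} (f : SmoothFun E W) (θ : OneForm E W)
    (s : P.val.obj (op W)) : formTensor.tmul P θ (f • s) = f • formTensor.tmul P θ s :=
  (congrArg (tmulLin P W) (TensorProduct.tmul_smul f θ s)).trans (map_smul _ _ _)

/-- For a single coefficient `g` this is `d (f g) = f d g + g d f` tensored with a basis section;
the general case follows by additivity. -/
theorem flatNabla_smul {W : Opens X} (h : W ≤ U) (f : SmoothFun E W) (c : I →₀ SmoothFun E W) :
    flatNabla e h (f • c) =
      formTensor.tmul P (exteriorD W f) (combination e h c) + f • flatNabla e h c := by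
  induction c using Finsupp.induction_linear with
  | zero => simp only [map_zero, smul_zero, tmul_zero_right, add_zero]
  | add c c' hc hc' =>
    rw [smul_add, map_add, hc, hc', map_add, map_add, tmul_add_right, smul_add]
    abel
  | single a g =>
    rw [Finsupp.smul_single, flatNabla_single, flatNabla_single, combination_single, smul_eq_mul,
      Derivation.leibniz, tmul_add_left, tmul_smul_left, tmul_smul_left, tmul_smul_right, add_comm]

variable {e}

/-- A sheaf with a local basis over `U` has a connection over `U`. -/
theorem IsLocalBasis.nonempty_connectionOn (he : IsLocalBasis e) :
    Nonempty (ConnectionOn P U) := by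
  refine ConnectionOn.nonempty_of_relation
    -- Linear independence over `W` makes `c` unique, hence also `t`. The spanning property supplies
    -- such a `c` only after shrinking, which is all that the relation needs.
    (fun W hW s t => ∃ c : I →₀ SmoothFun E W, s = combination e hW c ∧ t = flatNabla e hW c)
    ?_ ?_ ?_ ?_ ?_
  · rintro W V hW hV s t ⟨c, rfl, rfl⟩
    exact ⟨resCoeff hV c, res_combination e hW hV c, res_flatNabla e hW hV c⟩
  · rintro W hW s t t' ⟨c, hc, rfl⟩ ⟨c', hc', rfl⟩
    rw [he.linearIndependent W hW (hc.symm.trans hc')]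
  · rintro W hW s s' t t' ⟨c, rfl, rfl⟩ ⟨c', rfl, rfl⟩
    exact ⟨c + c', (map_add _ _ _).symm, (map_add _ _ _).symm⟩
  · rintro W hW f s t ⟨c, rfl, rfl⟩
    exact ⟨f • c, (map_smul _ _ _).symm, (flatNabla_smul e hW f c).symm⟩
  · intro V hV s x hx
    obtain ⟨W, hW, hxW, h⟩ := he.span V hV s x hx
    rw [Finsupp.mem_span_range_iff_exists_finsupp] at h
    obtain ⟨c, hc⟩ := h
    exact ⟨W, hW, _, hxW, c, hc.symm, rfl⟩

end Basis

section Glue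

variable {ι : Type} {V : ι → Opens X} (ρ : SmoothPartitionOfUnity ι 𝓘(ℝ, E) X Set.univ)

open Classical in
/-- The connection on `P` over `U`, with junk value zero on the open sets not contained in `U`. -/
def ConnectionOn.extend (c : ConnectionOn P U) (W : Opens X) :
    P.val.obj (op W) →+ (formTensor P).val.obj (op W) :=
  if h : W ≤ U then c.nabla W h else 0

theorem ConnectionOn.extend_of_le (c : ConnectionOn P U) {W : Opens X} (h : W ≤ U) :
    c.extend W = c.nabla W h := dif_pos h

/-- Connections over the members of an open cover are glued by a partition of unity. -/
theorem ConnectionOn.nonempty_top_of_partition (c : ∀ i, ConnectionOn P (V i))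
    (hρ : ρ.IsSubordinate fun i => (V i : Set X)) :
    Nonempty (ConnectionOn P (⊤ : Opens X)) := by
  refine ConnectionOn.nonempty_of_relation
    -- Any finite `S` is admitted that contains every index active on `W` and only indices with `W ≤
    -- V i`; the second condition keeps the junk value of `extend` out of the sum.
    (fun W _ s t => ∃ S : Finset ι, (∀ i ∈ S, W ≤ V i) ∧ (∀ i ∉ S, ∀ y ∈ W, ρ i y = 0) ∧
      t = ∑ i ∈ S, partitionOn ρ i W • (c i).extend W s) ?_ ?_ ?_ ?_ ?_
  · rintro W W' - hW' s t ⟨S, h1, h2, rfl⟩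
    refine ⟨S, fun i hi => hW'.trans (h1 i hi), fun i hi y hy => h2 i hi y (hW' hy), ?_⟩
    rw [map_sum]
    refine Finset.sum_congr rfl fun i hi => ?_
    rw [map_smulₛₗ, (c i).extend_of_le (h1 i hi), (c i).extend_of_le (hW'.trans (h1 i hi)),
      (c i).nabla_res]
    rfl
  · rintro W - s t t' ⟨S, -, h2, rfl⟩ ⟨S', -, h2', rfl⟩
    classical
    -- Both sums are enlarged to `S ∪ S'`. The added terms vanish because `ρ i` is zero on `W`,
    -- whatever the value of `extend`.
    rw [Finset.sum_subset (Finset.subset_union_left (s₁ := S) (s₂ := S')),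
      Finset.sum_subset (Finset.subset_union_right (s₁ := S) (s₂ := S'))]
    · intro i _ hi
      rw [partitionOn_eq_zero ρ (h2' i hi), zero_smul]
    · intro i _ hi
      rw [partitionOn_eq_zero ρ (h2 i hi), zero_smul]
  · rintro W - s s' t t' ⟨S, h1, h2, rfl⟩ ⟨S', h1', h2', rfl⟩
    classical
    refine ⟨S ∪ S', fun i hi => (Finset.mem_union.1 hi).elim (h1 i) (h1' i),
      fun i hi => h2 i fun h => hi (Finset.mem_union_left _ h), ?_⟩
    simp only [map_add, smul_add, Finset.sum_add_distrib]
    rw [Finset.sum_subset (Finset.subset_union_left (s₁ := S) (s₂ := S')),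
      Finset.sum_subset (Finset.subset_union_right (s₁ := S) (s₂ := S'))]
    · intro i _ hi
      rw [partitionOn_eq_zero ρ (h2' i hi), zero_smul]
    · intro i _ hi
      rw [partitionOn_eq_zero ρ (h2 i hi), zero_smul]
  · rintro W - f s t ⟨S, h1, h2, rfl⟩
    refine ⟨S, h1, h2, ?_⟩
    have h3 : ∀ i ∈ S, partitionOn ρ i W • (c i).extend W (f • s) =
        partitionOn ρ i W • formTensor.tmul P (exteriorD W f) s +
          f • (partitionOn ρ i W • (c i).extend W s) := fun i hi => by
      rw [(c i).extend_of_le (h1 i hi), (c i).leibniz, smul_add, smul_comm]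
    -- The symbol terms add up to `(∑ ρ i) • (d f ⊗ s) = d f ⊗ s`.
    rw [Finset.sum_congr rfl h3, Finset.sum_add_distrib, ← Finset.sum_smul, sum_partitionOn ρ h2,
      one_smul, Finset.smul_sum]
  · intro W _ s x hx
    obtain ⟨W', hW', hxW', S, h1, h2⟩ := exists_partition_nhds ρ hρ hx
    exact ⟨W', hW', _, hxW', S, h1, h2, rfl⟩

end Glue

/-- A connection over the whole manifold is a Koszul connection on the sheaf. -/
def ConnectionOn.toSheafKoszulConnection (c : ConnectionOn P (⊤ : Opens X)) :
    SheafKoszulConnection P where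
  nabla U := c.nabla U le_top
  nabla_restrict i s := (c.nabla_res le_top (leOfHom i) s).symm
  leibniz := c.leibniz le_top

/-- The cover is indexed by the points of `X`, one basis neighbourhood for each; the partition of
unity provides the local finiteness. -/
theorem nonempty_sheafKoszulConnection [FiniteDimensional ℝ E] [T2Space X] [SigmaCompactSpace X]
    (hP : P.IsLocallyFree) : Nonempty (SheafKoszulConnection P) := by
  choose V I e hxV he using exists_isLocalBasis hP
  obtain ⟨ρ, hρ⟩ := SmoothPartitionOfUnity.exists_isSubordinate 𝓘(ℝ, E) isClosed_univ
    (fun x : X => (V x : Set X)) (fun x => (V x).2) fun x _ => Set.mem_iUnion.2 ⟨x, hxV x⟩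
  obtain ⟨c⟩ := ConnectionOn.nonempty_top_of_partition
    ρ (fun x => (he x).nonempty_connectionOn.some) hρ
  exact ⟨c.toSheafKoszulConnection⟩

end Connections

end SmoothJets

end

noncomputable section

namespace SmoothJets

/-! ### Immersion of a second countable manifold into a finite-dimensional space. -/

section Immersion

open Module Filter Topology

variable {E X F G : Type} [NormedAddCommGroup E] [NormedSpace ℝ E] [TopologicalSpace X]
  [ChartedSpace E X] [NormedAddCommGroup F] [NormedSpace ℝ F] [NormedAddCommGroup G]
  [NormedSpace ℝ G]

theorem mfderiv_clm_comp {h : X → F} {x : X} (hh : MDifferentiableAt 𝓘(ℝ, E) 𝓘(ℝ, F) h x)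
    (A : F →L[ℝ] G) (v : TangentSpace 𝓘(ℝ, E) x) :
    mfderiv 𝓘(ℝ, E) 𝓘(ℝ, G) (fun y => A (h y)) x v = A (mfderiv 𝓘(ℝ, E) 𝓘(ℝ, F) h x v) := by
  have := A.hasMFDerivAt.comp x hh.hasMFDerivAt
  exact congrArg (fun z : TangentSpace 𝓘(ℝ, E) x →L[ℝ] G => z v) this.mfderiv

theorem injective_mfderiv_of_eq_zero {h : X → F} {x : X}
    (H : ∀ v, mfderiv 𝓘(ℝ, E) 𝓘(ℝ, F) h x v = 0 → v = 0) :
    Function.Injective (mfderiv 𝓘(ℝ, E) 𝓘(ℝ, F) h x) :=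
  (injective_iff_map_eq_zero (mfderiv 𝓘(ℝ, E) 𝓘(ℝ, F) h x)).2 H

theorem clm_mfderiv_eq_zero {h : X → F} {x : X} (hh : MDifferentiableAt 𝓘(ℝ, E) 𝓘(ℝ, F) h x)
    (A : F →L[ℝ] G) {v : TangentSpace 𝓘(ℝ, E) x} {u : F}
    (hu : u = mfderiv 𝓘(ℝ, E) 𝓘(ℝ, F) h x v)
    (hv : mfderiv 𝓘(ℝ, E) 𝓘(ℝ, G) (fun y => A (h y)) x v = 0) : A u = 0 := by
  rw [hu]
  exact (mfderiv_clm_comp hh A v).symm.trans hv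

variable [IsManifold 𝓘(ℝ, E) ∞ X]

/-- A neighbourhood of a point is immersed by a globally defined smooth map. -/
theorem exists_contMDiff_injective_mfderiv_near [FiniteDimensional ℝ E] [T2Space X] (x : X) :
    ∃ g : X → E, ContMDiff 𝓘(ℝ, E) 𝓘(ℝ, E) ∞ g ∧
      ∀ᶠ y in 𝓝 x, Function.Injective (mfderiv 𝓘(ℝ, E) 𝓘(ℝ, E) g y) := by
  let f : SmoothBumpFunction 𝓘(ℝ, E) x := Classical.arbitrary _
  refine ⟨fun y => f y • chartAt E x y, f.contMDiff_smul ?_, ?_⟩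
  · have := contMDiffOn_extChartAt (I := 𝓘(ℝ, E)) (n := ∞) (x := x)
    simpa only [mfld_simps] using this
  · filter_upwards [f.eventuallyEq_one.eventuallyEq_nhds, chart_source_mem_nhds E x] with y hy hys
    -- Where the bump function is locally one, the global map agrees with the chart, whose
    -- differential is injective.
    have h : (fun z => f z • chartAt E x z) =ᶠ[𝓝 y] chartAt E x := by
      filter_upwards [hy] with z hz
      rw [hz, Pi.one_apply, one_smul]
    rw [h.mfderiv_eq]
    exact LinearMap.ker_eq_bot.1 ((mdifferentiable_chart (I := 𝓘(ℝ, E)) x).ker_mfderiv_eq_bot hys)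

/-- Finitely many of the local immersions cover `K`. Their product is immersive at each point of
`K`, since one component already is. -/
theorem exists_immersion_on_compact [FiniteDimensional ℝ E] [T2Space X] {K : Set X}
    (hK : IsCompact K) : ∃ (N : ℕ) (g : X → Fin N → ℝ), ContMDiff 𝓘(ℝ, E) 𝓘(ℝ, Fin N → ℝ) ∞ g ∧
      ∀ x ∈ K, Function.Injective (mfderiv 𝓘(ℝ, E) 𝓘(ℝ, Fin N → ℝ) g x) := by
  choose g hg hg' using exists_contMDiff_injective_mfderiv_near (E := E) (X := X)
  obtain ⟨t, -, ht⟩ := hK.elim_nhds_subcover _ fun x _ => hg' x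
  let G : X → t → E := fun y i => g i y
  have hG : ContMDiff 𝓘(ℝ, E) 𝓘(ℝ, t → E) ∞ G := contMDiff_pi_space.2 fun i => hg i
  let A : (t → E) ≃L[ℝ] (Fin (finrank ℝ (t → E)) → ℝ) :=
    ContinuousLinearEquiv.ofFinrankEq (by simp)
  refine ⟨_, fun y => A (G y), A.contDiff.contMDiff.comp hG, fun x hx => ?_⟩
  obtain ⟨i, hit, hi⟩ := Set.mem_iUnion₂.1 (ht hx)
  refine injective_mfderiv_of_eq_zero fun v hv => ?_
  have hGx : MDifferentiableAt 𝓘(ℝ, E) 𝓘(ℝ, t → E) G x := hG.mdifferentiableAt (by simp)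
  obtain ⟨u, hu⟩ : ∃ u : t → E, u = mfderiv 𝓘(ℝ, E) 𝓘(ℝ, t → E) G x v := ⟨_, rfl⟩
  have h3 : A u = 0 := clm_mfderiv_eq_zero hGx A.toContinuousLinearMap hu hv
  have h2 := mfderiv_clm_comp hGx (ContinuousLinearMap.proj (R := ℝ) (φ := fun _ : t => E) ⟨i, hit⟩) v
  rw [map_eq_zero_iff A A.injective] at h3
  rw [← hu, h3, map_zero] at h2
  exact (injective_iff_map_eq_zero (mfderiv 𝓘(ℝ, E) 𝓘(ℝ, E) (g i) x)).1 hi v h2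

/-- The union of the images of the differentials of a smooth map has dimension at most twice that
of the manifold, so it misses a vector if the target is larger. -/
theorem exists_not_mem_range_mfderiv [FiniteDimensional ℝ E] [SecondCountableTopology X]
    [FiniteDimensional ℝ F] {h : X → F} (hh : ContMDiff 𝓘(ℝ, E) 𝓘(ℝ, F) ∞ h)
    (hF : 2 * finrank ℝ E < finrank ℝ F) :
    ∃ w : F, ∀ (x : X) (v : TangentSpace 𝓘(ℝ, E) x), mfderiv 𝓘(ℝ, E) 𝓘(ℝ, F) h x v ≠ w := by
  obtain ⟨C, hC, hCX⟩ := TopologicalSpace.countable_cover_nhds fun x : X => chart_source_mem_nhds E x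
  let g (c : X) : E → F := h ∘ (chartAt E c).symm
  -- In the chart at `c` tangent vectors are pairs (point, direction) in `E × E`, so `T c` is a `C¹`
  -- image of a set of Hausdorff dimension at most `2 dim E`. Countability of `C` preserves the
  -- bound for the union.
  let T (c : X) : Set F := (fun p : E × E => fderiv ℝ (g c) p.1 p.2) ''
    ((chartAt E c).target ×ˢ Set.univ)
  have hg (c : X) (y : E) (hy : y ∈ (chartAt E c).target) : ContDiffAt ℝ ∞ (g c) y := by
    rw [← contMDiffAt_iff_contDiffAt]
    refine hh.contMDiffAt.comp y ?_
    have := contMDiffOn_chart_symm (I := 𝓘(ℝ, E)) (n := ∞) (x := c)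
    exact this.contMDiffAt ((chartAt E c).open_target.mem_nhds hy)
  have hT (c : X) : dimH (T c) ≤ (2 * finrank ℝ E : ℕ) := by
    refine (dimH_image_le_of_locally_lipschitzOn fun p hp => ?_).trans ?_
    · have h1 : ContDiffAt ℝ 1 (fun p : E × E => fderiv ℝ (g c) p.1 p.2) p := by
        have h2 : ContDiffAt ℝ 1 (fderiv ℝ (g c)) p.1 :=
          (hg c p.1 hp.1).fderiv_right (m := 1) (WithTop.coe_le_coe.2 le_top)
        exact (h2.comp p contDiffAt_fst).clm_apply contDiffAt_snd
      obtain ⟨K, t, ht, hK⟩ := h1.exists_lipschitzOnWith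
      exact ⟨K, t, mem_nhdsWithin_of_mem_nhds ht, hK⟩
    · refine (dimH_mono (Set.subset_univ _)).trans ?_
      rw [Real.dimH_univ_eq_finrank, finrank_prod, two_mul]
  have hU : dimH (⋃ c ∈ C, T c) < finrank ℝ F := by
    rw [dimH_bUnion hC]
    exact (iSup₂_le fun c _ => hT c).trans_lt (by exact_mod_cast hF)
  obtain ⟨w, hw⟩ := (dense_compl_of_dimH_lt_finrank hU).nonempty
  refine ⟨w, fun x v hv => hw ?_⟩
  obtain ⟨c, hc, hxc⟩ := Set.mem_iUnion₂.1 (hCX.symm ▸ Set.mem_univ x :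
    x ∈ ⋃ c ∈ C, (chartAt E c).source)
  refine Set.mem_biUnion hc ⟨(chartAt E c x, mfderiv 𝓘(ℝ, E) 𝓘(ℝ, E) (chartAt E c) x v),
    ⟨(chartAt E c).map_source hxc, trivial⟩, ?_⟩
  have h1 : h =ᶠ[𝓝 x] g c ∘ chartAt E c := by
    filter_upwards [(chartAt E c).open_source.mem_nhds hxc] with y hy
    simp only [g, Function.comp_apply, (chartAt E c).left_inv hy]
  have h2 : MDifferentiableAt 𝓘(ℝ, E) 𝓘(ℝ, E) (chartAt E c) x :=
    (mdifferentiable_chart (I := 𝓘(ℝ, E)) c).1 x hxc |>.mdifferentiableAt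
      ((chartAt E c).open_source.mem_nhds hxc)
  have h3 : DifferentiableAt ℝ (g c) (chartAt E c x) :=
    (hg c _ ((chartAt E c).map_source hxc)).differentiableAt (by simp)
  rw [← hv, h1.mfderiv_eq, mfderiv_comp x h3.mdifferentiableAt h2, mfderiv_eq_fderiv]
  rfl

/-- The generic projection argument: an immersion can be projected to dimension `2 dim X`. -/
theorem exists_immersion_projection [FiniteDimensional ℝ E] [SecondCountableTopology X]
    (S : Set X) (N : ℕ) (h : X → Fin N → ℝ) (hh : ContMDiff 𝓘(ℝ, E) 𝓘(ℝ, Fin N → ℝ) ∞ h)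
    (hS : ∀ x ∈ S, Function.Injective (mfderiv 𝓘(ℝ, E) 𝓘(ℝ, Fin N → ℝ) h x)) :
    ∃ g : X → Fin (2 * finrank ℝ E) → ℝ, ContMDiff 𝓘(ℝ, E) 𝓘(ℝ, Fin (2 * finrank ℝ E) → ℝ) ∞ g ∧
      ∀ x ∈ S, Function.Injective (mfderiv 𝓘(ℝ, E) 𝓘(ℝ, Fin (2 * finrank ℝ E) → ℝ) g x) := by
  -- If the target is already small enough, a linear injection enlarges it to dimension exactly `2
  -- dim E`.
  have small (N : ℕ) (hN : N ≤ 2 * finrank ℝ E) (h : X → Fin N → ℝ)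
      (hh : ContMDiff 𝓘(ℝ, E) 𝓘(ℝ, Fin N → ℝ) ∞ h)
      (hS : ∀ x ∈ S, Function.Injective (mfderiv 𝓘(ℝ, E) 𝓘(ℝ, Fin N → ℝ) h x)) :
      ∃ g : X → Fin (2 * finrank ℝ E) → ℝ,
        ContMDiff 𝓘(ℝ, E) 𝓘(ℝ, Fin (2 * finrank ℝ E) → ℝ) ∞ g ∧
        ∀ x ∈ S, Function.Injective (mfderiv 𝓘(ℝ, E) 𝓘(ℝ, Fin (2 * finrank ℝ E) → ℝ) g x) := by
    obtain ⟨A, hA⟩ := (finrank_le_iff_exists_linearMap (R := ℝ) (M := Fin N → ℝ)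
      (M' := Fin (2 * finrank ℝ E) → ℝ)).1 (by simpa using hN)
    let A' := LinearMap.toContinuousLinearMap A
    refine ⟨fun y => A' (h y), A'.contDiff.contMDiff.comp hh, fun x hx => ?_⟩
    refine injective_mfderiv_of_eq_zero fun v hv => ?_
    obtain ⟨u, hu⟩ : ∃ u : Fin N → ℝ, u = mfderiv 𝓘(ℝ, E) 𝓘(ℝ, Fin N → ℝ) h x v := ⟨_, rfl⟩
    have h1 : A u = 0 := clm_mfderiv_eq_zero (hh.mdifferentiableAt (by simp)) A' hu hv
    rw [map_eq_zero_iff A hA] at h1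
    exact (injective_iff_map_eq_zero _).1 (hS x hx) v (hu.symm.trans h1)
  induction N with
  | zero => exact small 0 (Nat.zero_le _) h hh hS
  | succ N ih =>
    rcases le_or_gt (N + 1) (2 * finrank ℝ E) with hN | hN
    · exact small _ hN h hh hS
    -- A point is needed to see that `w ≠ 0`: zero is a value of the differential at `x₀`.
    rcases S.eq_empty_or_nonempty with rfl | ⟨x₀, hx₀⟩
    · exact ⟨fun _ => 0, contMDiff_const, fun x hx => hx.elim⟩
    obtain ⟨w, hw⟩ := exists_not_mem_range_mfderiv hh (by simpa using hN)
    have hw0 : w ≠ 0 := fun h0 => hw x₀ 0 (h0 ▸ map_zero _)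
    have hfr : finrank ℝ ((Fin (N + 1) → ℝ) ⧸ Submodule.span ℝ {w}) = N := by
      have := (Submodule.span ℝ {w}).finrank_quotient_add_finrank
      rw [finrank_span_singleton hw0, finrank_fin_fun] at this
      omega
    let e := LinearEquiv.ofFinrankEq ((Fin (N + 1) → ℝ) ⧸ Submodule.span ℝ {w}) (Fin N → ℝ)
      (R := ℝ) (by rw [hfr, finrank_fin_fun])
    -- Projection along the line of `w`. It keeps the differential injective because no nonzero
    -- multiple of `w` is a value of it.
    let A := e.toLinearMap ∘ₗ (Submodule.span ℝ {w}).mkQ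
    let A' := LinearMap.toContinuousLinearMap A
    refine ih (fun y => A' (h y)) (A'.contDiff.contMDiff.comp hh) fun x hx => ?_
    refine injective_mfderiv_of_eq_zero fun v hv => ?_
    obtain ⟨u, hu⟩ : ∃ u : Fin (N + 1) → ℝ, u = mfderiv 𝓘(ℝ, E) 𝓘(ℝ, Fin (N + 1) → ℝ) h x v :=
      ⟨_, rfl⟩
    have h1 : e ((Submodule.span ℝ {w}).mkQ u) = 0 :=
      clm_mfderiv_eq_zero (hh.mdifferentiableAt (by simp)) A' hu hv
    rw [map_eq_zero_iff e e.injective, Submodule.mkQ_apply, Submodule.Quotient.mk_eq_zero,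
      Submodule.mem_span_singleton] at h1
    obtain ⟨a, ha⟩ := h1
    have ha0 : a = 0 := by
      by_contra hne
      refine hw x (a⁻¹ • v) ?_
      rw [map_smul, ← hu, ← ha]
      exact inv_smul_smul₀ hne w
    rw [ha0, zero_smul] at ha
    exact (injective_iff_map_eq_zero _).1 (hS x hx) v (hu.symm.trans ha.symm)

/-- A second countable manifold has an immersion into a finite-dimensional space. -/
theorem exists_immersion [FiniteDimensional ℝ E] [T2Space X] [SecondCountableTopology X] :
    ∃ (N : ℕ) (g : X → Fin N → ℝ), ContMDiff 𝓘(ℝ, E) 𝓘(ℝ, Fin N → ℝ) ∞ g ∧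
      ∀ x, Function.Injective (mfderiv 𝓘(ℝ, E) 𝓘(ℝ, Fin N → ℝ) g x) := by
  have : LocallyCompactSpace X := ChartedSpace.locallyCompactSpace E X
  let n := 2 * finrank ℝ E
  -- The shift makes `K 0` empty, so that the shells `L j` cover `X` and the truncated `j - 1` in `O
  -- 0` removes nothing.
  let K : CompactExhaustion X := (CompactExhaustion.choice X).shiftr
  have hK0 : K 0 = ∅ := rfl
  let L (j : ℕ) : Set X := K (j + 1) \ interior (K j)
  let O (j : ℕ) : Set X := interior (K (j + 2)) \ K (j - 1)
  have hLc (j : ℕ) : IsCompact (L j) := (K.isCompact _).diff isOpen_interior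
  have hO (j : ℕ) : IsOpen (O j) := isOpen_interior.sdiff (K.isCompact _).isClosed
  have hLO (j : ℕ) : L j ⊆ O j := by
    refine fun x hx => ⟨K.subset_interior_succ _ hx.1, fun h => ?_⟩
    rcases j with - | j
    · rw [hK0] at h
      exact h
    · exact hx.2 (K.subset_interior_succ _ h)
  -- From `i + 3 ≤ j` follows `i + 2 ≤ j - 1`, so `O i` lies in the set removed from `O j`. Three
  -- residue classes of indices therefore suffice.
  have hOO (i j : ℕ) (hij : i + 3 ≤ j) : Disjoint (O i) (O j) :=
    Set.disjoint_left.2 fun x hx hx' => hx'.2 (K.subset (by omega) (interior_subset hx.1))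
  have hcov (x : X) : ∃ j, x ∈ L j := by
    have h := (CompactExhaustion.choice X).mem_sdiff_shiftr_find x
    exact ⟨_, h.1, fun h' => h.2 (interior_subset h')⟩
  -- The projection gives all shells the same target dimension `n`, so that maps of one colour can
  -- be added.
  have hg (j : ℕ) : ∃ g : X → Fin n → ℝ, ContMDiff 𝓘(ℝ, E) 𝓘(ℝ, Fin n → ℝ) ∞ g ∧
      ∀ x ∈ L j, Function.Injective (mfderiv 𝓘(ℝ, E) 𝓘(ℝ, Fin n → ℝ) g x) := by
    obtain ⟨N, g, hg, hg'⟩ := exists_immersion_on_compact (E := E) (hLc j)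
    exact exists_immersion_projection (L j) N g hg hg'
  choose g hg hgL using hg
  have hχ (j : ℕ) : ∃ f : C^∞⟮𝓘(ℝ, E), X; 𝓘(ℝ, ℝ), ℝ⟯, (∀ᶠ x in 𝓝ˢ (L j), f x = 1) ∧
      ∀ x ∉ O j, f x = 0 := by
    obtain ⟨f, h1, h2, -⟩ := exists_contMDiffMap_one_nhds_of_subset_interior 𝓘(ℝ, E) (n := ⊤)
      (hLc j).isClosed ((hO j).interior_eq.symm ▸ hLO j : L j ⊆ interior (O j))
    exact ⟨f, h1, h2⟩
  choose χ hχ1 hχ0 using hχ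
  -- Neighbourhoods `O j` of equal colour are disjoint, so near `L j` the component of colour `j %
  -- 3` of the sum below is `g j` itself.
  let t (c : Fin 3) (j : ℕ) (x : X) : Fin n → ℝ := if j % 3 = c then χ j x • g j x else 0
  have ht0 (c : Fin 3) (j : ℕ) (x : X) (hx : x ∉ O j) : t c j x = 0 := by
    simp only [t, hχ0 j x hx, zero_smul, ite_self]
  have ht (c : Fin 3) (j : ℕ) : ContMDiff 𝓘(ℝ, E) 𝓘(ℝ, Fin n → ℝ) ∞ (t c j) := by
    by_cases h : j % 3 = c
    · have := (χ j).contMDiff.smul (hg j)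
      simp only [t, h, if_true]
      exact this
    · simpa only [t, h, if_false] using contMDiff_const
  have hlf (c : Fin 3) : LocallyFinite fun j => Function.support (t c j) := by
    intro x
    obtain ⟨m, hm⟩ := K.exists_mem_nhds x
    refine ⟨K m, hm, (Set.finite_le_nat m).subset ?_⟩
    rintro j ⟨y, hy, hym⟩
    by_contra hj
    exact hy (ht0 c j y fun h => h.2 (K.subset (by simp at hj; omega) hym))
  let H : X → Fin 3 → Fin n → ℝ := fun x c => ∑ᶠ j, t c j x
  have hH : ContMDiff 𝓘(ℝ, E) 𝓘(ℝ, Fin 3 → Fin n → ℝ) ∞ H :=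
    contMDiff_pi_space.2 fun c => contMDiff_finsum (ht c) (hlf c)
  let A : (Fin 3 → Fin n → ℝ) ≃L[ℝ] (Fin (finrank ℝ (Fin 3 → Fin n → ℝ)) → ℝ) :=
    ContinuousLinearEquiv.ofFinrankEq (by simp)
  refine ⟨_, fun y => A (H y), A.contDiff.contMDiff.comp hH, fun x => ?_⟩
  obtain ⟨j, hj⟩ := hcov x
  let c : Fin 3 := ⟨j % 3, Nat.mod_lt _ (by norm_num)⟩
  have hloc : (fun y => H y c) =ᶠ[𝓝 x] g j := by
    filter_upwards [(hO j).mem_nhds (hLO j hj), (eventually_nhdsSet_iff_forall.1 (hχ1 j)) x hj]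
      with y hyO hy1
    change ∑ᶠ i, t c i y = g j y
    rw [finsum_eq_single _ j]
    · simp only [t, c, if_true, hy1, one_smul]
    · intro i hi
      by_cases hic : i % 3 = c
      · refine ht0 c i y fun hyi => ?_
        have hic' : i % 3 = j % 3 := hic
        rcases lt_or_gt_of_ne hi with h | h
        · exact Set.disjoint_left.1 (hOO i j (by omega)) hyi hyO
        · exact Set.disjoint_left.1 (hOO j i (by omega)) hyO hyi
      · simp only [t, hic, if_false]
  refine injective_mfderiv_of_eq_zero fun v hv => ?_
  have hHx : MDifferentiableAt 𝓘(ℝ, E) 𝓘(ℝ, Fin 3 → Fin n → ℝ) H x := hH.mdifferentiableAt (by simp)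
  obtain ⟨u, hu⟩ : ∃ u : Fin 3 → Fin n → ℝ,
    u = mfderiv 𝓘(ℝ, E) 𝓘(ℝ, Fin 3 → Fin n → ℝ) H x v := ⟨_, rfl⟩
  have h3 : A u = 0 := clm_mfderiv_eq_zero hHx A.toContinuousLinearMap hu hv
  rw [map_eq_zero_iff A A.injective] at h3
  have h2 := mfderiv_clm_comp hHx
    (ContinuousLinearMap.proj (R := ℝ) (φ := fun _ : Fin 3 => Fin n → ℝ) c) v
  rw [← hu, h3, map_zero] at h2
  have h4 := hloc.mfderiv_eq (I := 𝓘(ℝ, E)) (I' := 𝓘(ℝ, Fin n → ℝ))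
  refine (injective_iff_map_eq_zero (mfderiv 𝓘(ℝ, E) 𝓘(ℝ, Fin n → ℝ) (g j) x)).1 (hgL j x hj) v ?_
  rw [← h4]
  exact h2

end Immersion

end SmoothJets

end

noncomputable section

namespace SmoothJets

/-! ### Dual vector fields from the Gram form, and the finite frame. -/

section Gram

variable {E ι : Type} [NormedAddCommGroup E] [NormedSpace ℝ E] [Fintype ι]

/-- The Gram form `u ↦ ∑ j, h j u • h j` of a family of covectors. -/
def gram (h : ι → E →L[ℝ] ℝ) : E →L[ℝ] E →L[ℝ] ℝ :=
  ∑ j, ContinuousLinearMap.smulRightL ℝ E (E →L[ℝ] ℝ) (h j) (h j)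

theorem gram_apply (h : ι → E →L[ℝ] ℝ) (u : E) : gram h u = ∑ j, h j u • h j := by
  rw [gram, _root_.sum_apply]
  rfl

theorem gram_symm (h : ι → E →L[ℝ] ℝ) (u v : E) : gram h u v = gram h v u := by
  simp only [gram_apply, _root_.sum_apply, _root_.smul_apply, smul_eq_mul]
  exact Finset.sum_congr rfl fun j _ => mul_comm _ _

/-- The Gram form of a family of covectors without common zeros is invertible. -/
theorem exists_equiv_eq_gram [FiniteDimensional ℝ E] {h : ι → E →L[ℝ] ℝ}
    (hh : ∀ u, (∀ j, h j u = 0) → u = 0) :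
    ∃ e : E ≃L[ℝ] (E →L[ℝ] ℝ), (e : E →L[ℝ] E →L[ℝ] ℝ) = gram h := by
  have hinj : Function.Injective (gram h : E →ₗ[ℝ] E →L[ℝ] ℝ) := by
    rw [injective_iff_map_eq_zero]
    intro u hu
    -- The form is positive definite: `gram h u u` is the sum of the squares of the `h j u`.
    have h1 : gram h u u = 0 := congrArg (fun z : E →L[ℝ] ℝ => z u) hu
    rw [gram_apply, _root_.sum_apply] at h1
    refine hh u fun j => mul_self_eq_zero.1 ?_
    exact (Finset.sum_eq_zero_iff_of_nonneg fun j _ => mul_self_nonneg (h j u)).1 h1 j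
      (Finset.mem_univ j)
  have hfr : Module.finrank ℝ E = Module.finrank ℝ (E →L[ℝ] ℝ) := by
    rw [← (LinearMap.toContinuousLinearMap (𝕜 := ℝ) (E := E) (F' := ℝ)).finrank_eq]
    exact (Subspace.dual_finrank_eq (K := ℝ) (V := E)).symm
  exact ⟨(LinearEquiv.ofInjectiveOfFinrankEq _ hinj hfr).toContinuousLinearEquiv,
    ContinuousLinearMap.ext fun u => rfl⟩

theorem inverse_gram_apply [FiniteDimensional ℝ E] {h : ι → E →L[ℝ] ℝ}
    (hh : ∀ u, (∀ j, h j u = 0) → u = 0) (u : E) : (gram h).inverse (gram h u) = u := by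
  obtain ⟨e, he⟩ := exists_equiv_eq_gram hh
  rw [← he, ContinuousLinearMap.inverse_equiv]
  exact e.symm_apply_apply u

-- The Gram form is quadratic in the covectors, and inversion is smooth at an invertible map. This
-- is where smoothness of the dual vector fields comes from.
set_option synthInstance.maxHeartbeats 400000 in
theorem contDiffAt_inverse_gram [FiniteDimensional ℝ E] {h₀ : ι → E →L[ℝ] ℝ}
    (hh : ∀ u, (∀ j, h₀ j u = 0) → u = 0) (k : ι) :
    ContDiffAt ℝ ∞ (fun h : ι → E →L[ℝ] ℝ => (gram h).inverse (h k)) h₀ := by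
  have hG : ContDiff ℝ ∞ (gram : (ι → E →L[ℝ] ℝ) → E →L[ℝ] E →L[ℝ] ℝ) := by
    refine ContDiff.sum fun j _ => ?_
    exact ((ContinuousLinearMap.contDiff _).comp (contDiff_apply ℝ _ j)).clm_apply
      (contDiff_apply ℝ _ j)
  obtain ⟨e, he⟩ := exists_equiv_eq_gram hh
  have hinv : ContDiffAt ℝ ∞ (ContinuousLinearMap.inverse : (E →L[ℝ] E →L[ℝ] ℝ) → _)
      (gram h₀) := he ▸ contDiffAt_map_inverse e
  exact (hinv.comp h₀ hG.contDiffAt).clm_apply (contDiff_apply ℝ (E →L[ℝ] ℝ) k).contDiffAt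

/-- The vectors dual, under the Gram form, to the given covectors. -/
theorem exists_dual_vectors [FiniteDimensional ℝ E] {h : ι → E →L[ℝ] ℝ}
    (hh : ∀ u, (∀ j, h j u = 0) → u = 0) :
    ∃ v : ι → E, (∀ k, gram h (v k) = h k) ∧ ∀ θ : E →L[ℝ] ℝ, θ = ∑ k, θ (v k) • h k := by
  obtain ⟨e, he⟩ := exists_equiv_eq_gram hh
  have he' (u : E) : gram h u = e u := by rw [← he]; rfl
  have hv (k : ι) : gram h (e.symm (h k)) = h k := by rw [he', e.apply_symm_apply]
  refine ⟨fun k => e.symm (h k), hv, fun θ => ?_⟩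
  -- Write `θ = gram h u = ∑ h k u • h k`. By symmetry of the form `h k u = gram h (v k) u = gram h
  -- u (v k) = θ (v k)`.
  obtain ⟨u, rfl⟩ := e.surjective θ
  rw [← he']
  conv_lhs => rw [gram_apply]
  refine Finset.sum_congr rfl fun k _ => ?_
  rw [gram_symm, hv]

end Gram

section VectorFields

variable {E X : Type} [NormedAddCommGroup E] [NormedSpace ℝ E] [TopologicalSpace X]
  [ChartedSpace E X] [IsManifold 𝓘(ℝ, E) ∞ X]

/-- The coordinates near `x₀` of a one-form are smooth at `x₀`. -/
theorem contMDiffAt_form_comp_symmL {U : Opens X} (θ : OneForm E U) (x₀ : U) :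
    ContMDiffAt 𝓘(ℝ, E) 𝓘(ℝ, E →L[ℝ] ℝ) ∞ (fun x : U => (θ.1 x).comp
      ((trivializationAt E (TangentSpace 𝓘(ℝ, E)) (x₀ : X)).symmL ℝ (x : X))) x₀ := by
  refine (isSmoothForm_iff.1 θ.2 x₀).congr_of_eventuallyEq (Filter.Eventually.of_forall fun x => ?_)
  refine Eq.trans ?_ (congrArg Prod.snd (hom_trivializationAt_apply (F₁ := E)
    (E₁ := (TangentSpace 𝓘(ℝ, E) : X → Type)) (F₂ := ℝ) (E₂ := Bundle.Trivial X ℝ)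
    (RingHom.id ℝ) (x₀ : X) ⟨(x : X), θ.1 x⟩)).symm
  simp only [ContinuousLinearMap.inCoordinates]
  exact (congrArg (fun g : ℝ →L[ℝ] ℝ => g.comp ((θ.1 x).comp
      ((trivializationAt E (TangentSpace 𝓘(ℝ, E)) (x₀ : X)).symmL ℝ (x : X))))
    (Bundle.Trivial.continuousLinearMapAt_trivialization ℝ X ℝ (x : X))).symm

/-- A field of tangent vectors is smooth if it maps smooth one-forms to smooth functions. -/
def IsSmoothField (v : (x : X) → TangentSpace 𝓘(ℝ, E) x) : Prop :=
  ∀ (U : Opens X) (θ : OneForm E U),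
    ContMDiff 𝓘(ℝ, E) 𝓘(ℝ, ℝ) ∞ fun x : U => θ.1 x (v (x : X))

/-- One-forms without common zeros have smooth dual vector fields. -/
theorem exists_dual_fields [FiniteDimensional ℝ E] {ι : Type} [Fintype ι]
    (η : ι → OneForm E (⊤ : Opens X))
    (hη : ∀ (x : (⊤ : Opens X)) (u : TangentSpace 𝓘(ℝ, E) (x : X)),
      (∀ j, (η j).1 x u = 0) → u = 0) :
    ∃ v : ι → (x : X) → TangentSpace 𝓘(ℝ, E) x, (∀ k, IsSmoothField (v k)) ∧
      ∀ (x : (⊤ : Opens X)) (θ : TangentSpace 𝓘(ℝ, E) (x : X) →L[ℝ] ℝ),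
        θ = ∑ k, θ (v k x) • (η k).1 x := by
  have key (x : X) : ∃ v : ι → TangentSpace 𝓘(ℝ, E) x,
      (∀ k, ∑ j, (η j).1 ⟨x, trivial⟩ (v k) • (η j).1 ⟨x, trivial⟩ = (η k).1 ⟨x, trivial⟩) ∧
      ∀ θ : TangentSpace 𝓘(ℝ, E) x →L[ℝ] ℝ, θ = ∑ k, θ (v k) • (η k).1 ⟨x, trivial⟩ := by
    obtain ⟨v, h1, h2⟩ := exists_dual_vectors (E := E) (h := fun j => (η j).1 ⟨x, trivial⟩)
      (hη ⟨x, trivial⟩)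
    exact ⟨v, fun k => (gram_apply (E := E) _ _).symm.trans (h1 k), h2⟩
  -- The choice is pointwise, but the Gram equation `hv` determines `v`. In a trivialization the
  -- field is `(gram (c x)).inverse (c x k)`, which is smooth in `x`.
  choose v hv hv' using key
  refine ⟨fun k x => v x k, fun k U θ x₀ => ?_, fun x θ => hv' x θ⟩
  let e := trivializationAt E (TangentSpace 𝓘(ℝ, E)) (x₀ : X)
  let c (x : U) (j : ι) : E →L[ℝ] ℝ :=
    ((OneForm.restrict le_top (η j) : OneForm E U).1 x).comp (e.symmL ℝ (x : X))
  have hc (j : ι) : ContMDiffAt 𝓘(ℝ, E) 𝓘(ℝ, E →L[ℝ] ℝ) ∞ (fun x => c x j) x₀ :=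
    contMDiffAt_form_comp_symmL _ x₀
  have hx₀ : (x₀ : X) ∈ e.baseSet := FiberBundle.mem_baseSet_trivializationAt' (x₀ : X)
  have hnd (x : U) (hx : (x : X) ∈ e.baseSet) (u : E) (hu : ∀ j, c x j u = 0) : u = 0 := by
    have h1 : e.symmL ℝ (x : X) u = 0 := hη ⟨x, trivial⟩ _ hu
    rw [← e.continuousLinearMapAt_symmL (R := ℝ) hx u, h1, map_zero]
  have hcoord (x : U) (hx : (x : X) ∈ e.baseSet) :
      gram (c x) (e.continuousLinearMapAt ℝ (x : X) (v x k)) = c x k := by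
    rw [gram_apply]
    ext u
    have h1 := congrArg (fun z : TangentSpace 𝓘(ℝ, E) (x : X) →L[ℝ] ℝ => z (e.symmL ℝ (x : X) u))
      (hv x k)
    have h2 (j : ι) : c x j (e.continuousLinearMapAt ℝ (x : X) (v x k)) =
        (η j).1 ⟨x, trivial⟩ (v x k) := by
      change (η j).1 ⟨x, trivial⟩ (e.symmL ℝ (x : X) (e.continuousLinearMapAt ℝ (x : X) (v x k))) = _
      rw [e.symmL_continuousLinearMapAt (R := ℝ) hx]
    simp only [h2, _root_.sum_apply]
    simp only [_root_.sum_apply] at h1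
    exact h1
  have hw : ContMDiffAt 𝓘(ℝ, E) 𝓘(ℝ, E) ∞
      (fun x : U => e.continuousLinearMapAt ℝ (x : X) (v x k)) x₀ := by
    refine ((contDiffAt_inverse_gram (hnd x₀ hx₀) k).comp_contMDiffAt
      (f := c) (contMDiffAt_pi_space.2 hc)).congr_of_eventuallyEq ?_
    filter_upwards [continuous_subtype_val.continuousAt.eventually_mem
      (e.open_baseSet.mem_nhds hx₀)] with x hx
    change _ = (gram (c x)).inverse (c x k)
    rw [← hcoord x hx, inverse_gram_apply (hnd x hx)]
  refine ((contMDiffAt_form_comp_symmL θ x₀).clm_apply hw).congr_of_eventuallyEq ?_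
  filter_upwards [continuous_subtype_val.continuousAt.eventually_mem
    (e.open_baseSet.mem_nhds hx₀)] with x hx
  change θ.1 x (v x k) = θ.1 x (e.symmL ℝ (x : X) (e.continuousLinearMapAt ℝ (x : X) (v x k)))
  rw [e.symmL_continuousLinearMapAt (R := ℝ) hx]

variable (E X) in
/-- The exterior differential is a finite combination `d f = ∑ k, df(v k) • η k`. -/
theorem exists_finite_frame [FiniteDimensional ℝ E] [T2Space X] [SecondCountableTopology X] :
    ∃ (N : ℕ) (η : Fin N → OneForm E (⊤ : Opens X))
      (v : Fin N → (x : X) → TangentSpace 𝓘(ℝ, E) x), (∀ k, IsSmoothField (v k)) ∧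
      ∀ (x : (⊤ : Opens X)) (θ : TangentSpace 𝓘(ℝ, E) (x : X) →L[ℝ] ℝ),
        θ = ∑ k, θ (v k x) • (η k).1 x := by
  obtain ⟨N, g, hg, hg'⟩ := exists_immersion (E := E) (X := X)
  let f (k : Fin N) : SmoothFun E (⊤ : Opens X) :=
    ⟨fun x => g x k, (contMDiff_pi_space.1 hg k).comp contMDiff_subtype_val⟩
  refine ⟨N, fun k => exteriorD ⊤ (f k), exists_dual_fields _ fun x u hu => ?_⟩
  -- A common zero of the differentials of all components lies in the kernel of the differential of
  -- the immersion.
  refine (injective_iff_map_eq_zero (mfderiv 𝓘(ℝ, E) 𝓘(ℝ, Fin N → ℝ) g x)).1 (hg' x) u ?_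
  refine funext fun k => ?_
  have h1 := mfderiv_clm_comp (hg.mdifferentiableAt (x := (x : X)) (by simp))
    (ContinuousLinearMap.proj (R := ℝ) (φ := fun _ : Fin N => ℝ) k) u
  refine h1.symm.trans (Eq.trans ?_ (hu k))
  have h2 : extendZero (f k) = fun y => g y k :=
    funext fun y => extendZero_apply (f k) ⟨y, trivial⟩
  rw [exteriorD_apply, h2]
  rfl

end VectorFields

/-! ### Contraction with vector fields and connections on global sections. -/

section Contraction

variable {E X : Type} [NormedAddCommGroup E] [NormedSpace ℝ E] [TopologicalSpace X]
  [ChartedSpace E X] [IsManifold 𝓘(ℝ, E) ∞ X] {v : (x : X) → TangentSpace 𝓘(ℝ, E) x}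

/-- The contraction of one-forms with a smooth vector field. -/
def IsSmoothField.contract (hv : IsSmoothField v) (U : Opens X) :
    OneForm E U →ₗ[SmoothFun E U] SmoothFun E U where
  toFun θ := ⟨fun x => θ.1 x (v x), hv U θ⟩
  map_add' _ _ := rfl
  map_smul' _ _ := rfl

variable (P : SheafOfModules.{0} (smoothRingSheaf E X))

/-- The contraction `𝒪¹(U) ⊗ P(U) → P(U)` with a smooth vector field. -/
def IsSmoothField.contractTensor (hv : IsSmoothField v) (U : Opens X) :
    OneForm E U ⊗[SmoothFun E U] P.val.obj (op U) →ₗ[SmoothFun E U] P.val.obj (op U) :=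
  TensorProduct.lift ((LinearMap.lsmul (SmoothFun E U) (P.val.obj (op U))).comp (hv.contract U))

/-- The contraction `𝒪¹ ⊗ P → P` with a smooth vector field. -/
def IsSmoothField.contractSheaf (hv : IsSmoothField v) : formTensor P ⟶ P :=
  sheafifyLift
    { app := fun U => ModuleCat.ofHom (R := (smoothRingSheaf E X).obj.obj U)
        (X := (formTensorPresheaf P.val).obj U) (Y := P.val.obj U) (hv.contractTensor P U.unop)
      naturality := fun {U V} i => by
        refine ModuleCat.hom_ext (LinearMap.ext fun t => ?_)
        let F : OneForm E (X := X) U.unop ⊗[SmoothFun E (X := X) U.unop] P.val.obj U →+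
            P.val.obj V :=
          (hv.contractTensor P V.unop).toAddMonoidHom.comp
            ((formTensorPresheaf P.val).map i).hom.toAddMonoidHom
        let G : OneForm E (X := X) U.unop ⊗[SmoothFun E (X := X) U.unop] P.val.obj U →+
            P.val.obj V :=
          (res P (leOfHom i.unop)).toAddMonoidHom.comp (hv.contractTensor P U.unop).toAddMonoidHom
        exact TensorProduct.induction_on (motive := fun t => F t = G t) t
          ((map_zero F).trans (map_zero G).symm)
          (fun θ p => (map_smulₛₗ (res P (leOfHom i.unop)) (hv.contract U.unop θ) p).symm)
          (fun x y hx hy => by rw [map_add, map_add, hx, hy]) }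

theorem IsSmoothField.contractSheaf_tmul (hv : IsSmoothField v) {U : Opens X} (θ : OneForm E U)
    (s : P.val.obj (op U)) :
    Hom.on (hv.contractSheaf P) U (formTensor.tmul P θ s) = hv.contract U θ • s :=
  sheafifyLift_toSheafify (Q := formTensorPresheaf P.val) _ U _

variable {P}

/-- A Koszul connection on a sheaf induces one on the module of its global sections. -/
theorem SheafKoszulConnection.nonempty_koszulConnection [FiniteDimensional ℝ E] [T2Space X]
    [SecondCountableTopology X] (c : SheafKoszulConnection P) :
    Nonempty (KoszulConnection (exteriorD (E := E) (⊤ : Opens X))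
      (P.val.obj (op (⊤ : Opens X)))) := by
  obtain ⟨N, η, v, hv, hη⟩ := exists_finite_frame E X
  refine ⟨KoszulConnection.ofCovariantDerivatives η
    (fun k f => (hv k).contract ⊤ (exteriorD ⊤ f)) (fun f => ?_)
    -- The covariant derivative along `v k` takes values in `P(X)`, so no comparison of `𝒪¹(X) ⊗
    -- P(X)` with the global sections of the sheaf `𝒪¹ ⊗ P` is required.
    (fun k => (Hom.on ((hv k).contractSheaf P) ⊤).toAddMonoidHom.comp (c.nabla ⊤))
    (fun k f s => ?_)⟩
  · refine Subtype.ext (funext fun x => (hη x _).trans ?_)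
    let ev : OneForm E (⊤ : Opens X) →+ (TangentSpace 𝓘(ℝ, E) (x : X) →L[ℝ] ℝ) :=
      { toFun := fun θ => θ.1 x, map_zero' := rfl, map_add' := fun _ _ => rfl }
    exact (map_sum ev (fun k => (hv k).contract ⊤ (exteriorD ⊤ f) • η k) Finset.univ).symm
  · change Hom.on ((hv k).contractSheaf P) ⊤ (c.nabla ⊤ (f • s)) =
      _ + f • Hom.on ((hv k).contractSheaf P) ⊤ (c.nabla ⊤ s)
    rw [c.leibniz, map_add, map_smul, (hv k).contractSheaf_tmul]

end Contraction

end SmoothJets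

end

/-- Every locally free sheaf `P` of `C^∞_X`-modules on a smooth manifold `X` admits a connection (a
splitting of the jet sequence; a Koszul connection), and so does every locally free
`C^∞(X)`-module. -/
theorem proposition1p7 (E X : Type) [NormedAddCommGroup E] [NormedSpace ℝ E]
    [FiniteDimensional ℝ E] [TopologicalSpace X] [T2Space X] [SecondCountableTopology X]
    [ChartedSpace E X] [IsManifold 𝓘(ℝ, E) ∞ X] :
    (∀ P : SheafOfModules.{0} (smoothRingSheaf E X), P.IsLocallyFree →
      Nonempty (jetSheafSequence P).Splitting ∧ Nonempty (SheafKoszulConnection P)) ∧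
    (∀ (Q : Type) [AddCommGroup Q] [Module (SmoothFun E (⊤ : Opens X)) Q],
      IsLocallyFreeModule E X Q →
        Nonempty (jetSequence (exteriorD (E := E) (⊤ : Opens X)) Q).Splitting ∧
          Nonempty (KoszulConnection (exteriorD (E := E) (⊤ : Opens X)) Q)) := by
  -- Together with second countability this yields the σ-compactness assumed in
  -- `nonempty_sheafKoszulConnection`.
  have : LocallyCompactSpace X := ChartedSpace.locallyCompactSpace E X
  refine ⟨fun P hP => ?_, fun Q _ _ hQ => ?_⟩
  · obtain ⟨c⟩ := nonempty_sheafKoszulConnection hP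
    exact ⟨⟨c.splitting⟩, ⟨c⟩⟩
  · obtain ⟨P, hP, ⟨e⟩⟩ := hQ
    obtain ⟨c⟩ := nonempty_sheafKoszulConnection hP
    obtain ⟨k⟩ := c.nonempty_koszulConnection
    exact ⟨⟨(k.congr e).splitting⟩, ⟨k.congr e⟩⟩
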